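/- Let $n\ge 1$. Let $E=\{v\in\mathbb{R}^{n+1} : \sum_k v_k=0\}$ with the standard inner product, let $\Phi=\{e_i-e_j : i\ne j\}\subset E$ be the root system of type $A_n$ with simple roots $\Delta=\{\alpha_1,\dots,\alpha_n\}$, $\alpha_i=e_i-e_{i+1}$, and positive roots $\Phi_+=\{e_i-e_j : i<j\}$. Let $\varpi_1,\dots,\varpi_n$ be the fundamental weights and put $\varpi_0=0$. Let $C_+=\{v\in E : (\alpha,v)>0 \text{ for all } \alpha\in\Phi_+\}$ be the open dominant chamber, $\overline{C_+}$ its closure, and $\mathbb{R}_{\ge 0}\Delta=\{\sum_{i} c_i\alpha_i : c_i\ge 0\}$. Let $W$ be the affine Weyl group of type $\widetilde{A}_n$, that is, the group of transformations of $E$ generated by the orthogonal reflections $s_{\alpha,k}$ through the hyperplanes $H_{\alpha,k}=\{v\in E : (\alpha,v)=k\}$, $\alpha\in\Phi$, $k\in\mathbb{Z}$. Let the fundamental alcove be $A_{\mathrm{id}}=\{v\in E : -1<(\alpha,v)<0 \text{ for all } \alpha\in\Phi_+\}$, whose vertices are $-\varpi_0,-\varpi_1,\dots,-\varpi_n$.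 The reflections in the walls of $A_{\mathrm{id}}$ are the Coxeter generators of $W$, and $\le$ is the corresponding Bruhat order, with intervals $[x,y]=\{z\in W : x\le z\le y\}$. Put $A_x=x(A_{\mathrm{id}})$ for $x\in W$, and let $W_+=\{x\in W : A_x\subset C_+\}$ be the set of dominant elements. For $x,y\in W_+$ and $0\le i\le n$ let $$\operatorname{Par}^i_{x,y}=\bigl(x(-\varpi_i)+\mathbb{R}_{\ge 0}\Delta\bigr)\cap\bigl(y(-\varpi_i)-\mathbb{R}_{\ge 0}\Delta\bigr).$$ Then for all $x,y\in W_+$ and every $z\in W$, $$z\in[x,y]\cap W_+\quad\Longleftrightarrow\quad z(-\varpi_i)\in\operatorname{Par}^i_{x,y}\cap\overline{C_+}\ \text{ for all } i\in\{0,1,\dots,n\}.$$ -/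

import Mathlib

/-! Bruhat order of a group `G` with respect to a set `S` of Coxeter generators. -/

namespace Bruhat

variable {G : Type*} [Group G]

/-- The length of `w`: the least `k` such that `w` is a product of `k` elements of `S`. -/
noncomputable def length (S : Set G) (w : G) : ℕ :=
  sInf {k : ℕ | ∃ l : List G, (∀ s ∈ l, s ∈ S) ∧ l.prod = w ∧ l.length = k}

/-- The reflections: the conjugates of the elements of `S`. -/
def IsReflection (S : Set G) (t : G) : Prop :=
  ∃ w : G, ∃ s ∈ S, t = w * s * w⁻¹

/-- `u → w`: we have `w = u t` for a reflection `t`, and `ℓ(u) < ℓ(w)`. -/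
def Step (S : Set G) (u w : G) : Prop :=
  ∃ t : G, IsReflection S t ∧ w = u * t ∧ length S u < length S w

/-- The Bruhat order: there is a chain `u = u₀ → u₁ → ⋯ → u_k = w`. -/
def LE (S : Set G) (u w : G) : Prop :=
  Relation.ReflTransGen (Step S) u w

/-- The Bruhat interval `[x, y]`. -/
def interval (S : Set G) (x y : G) : Set G :=
  {z : G | LE S x z ∧ LE S z y}

end Bruhat

/-! The affine Weyl group of type `Ãₙ`, in the standard realization. -/

namespace AffineA

/-- The orthogonal reflection `s_{α,k}` through the hyperplane
`H_{α,k} = {v | (α, v) = k}` (the identity if `α = 0`). -/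
noncomputable def affineReflection {V : Type*} [NormedAddCommGroup V] [InnerProductSpace ℝ V]
    (α : V) (k : ℤ) : Equiv.Perm V :=
  Function.Involutive.toPerm
    (fun v => v - (2 * (inner ℝ α v - (k : ℝ)) / inner ℝ α α) • α) (by
      intro v
      by_cases h : α = 0
      · simp [h]
      · have h' : inner ℝ α α ≠ 0 := inner_self_ne_zero.mpr h
        have h2 : inner ℝ α (v - (2 * (inner ℝ α v - (k : ℝ)) / inner ℝ α α) • α)
            = 2 * (k : ℝ) - inner ℝ α v := by
          rw [inner_sub_right, real_inner_smul_right]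
          field_simp
          ring
        simp only [h2]
        rw [sub_sub, ← add_smul]
        have h3 : 2 * (inner ℝ α v - (k : ℝ)) / inner ℝ α α
            + 2 * (2 * (k : ℝ) - inner ℝ α v - (k : ℝ)) / inner ℝ α α = 0 := by
          field_simp
          ring
        rw [h3, zero_smul, sub_zero])

/-- The Euclidean space `E` of the root system of type `Aₙ`: the vectors of `ℝⁿ⁺¹` whose
coordinates sum to zero. -/
def E (n : ℕ) : Submodule ℝ (EuclideanSpace ℝ (Fin (n + 1))) where
  carrier := {v | ∑ k, v k = 0}
  add_mem' := by
    intro a b ha hb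
    simp only [Set.mem_ofPred_eq, PiLp.add_apply, Finset.sum_add_distrib] at *
    rw [ha, hb, add_zero]
  zero_mem' := by simp
  smul_mem' := by
    intro c a ha
    simp only [Set.mem_ofPred_eq, PiLp.smul_apply, smul_eq_mul, ← Finset.mul_sum] at *
    rw [ha, mul_zero]

/-- The vector `e_i - e_j`. -/
noncomputable def root (n : ℕ) (i j : Fin (n + 1)) : E n :=
  ⟨EuclideanSpace.single i (1 : ℝ) - EuclideanSpace.single j (1 : ℝ), by
    simp [E, PiLp.single_apply]⟩

/-- The root system `Φ` of type `Aₙ`. All roots have squared length `2`, so that roots and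
coroots coincide. -/
def roots (n : ℕ) : Set (E n) := {α | ∃ i j : Fin (n + 1), i ≠ j ∧ α = root n i j}

/-- The positive roots `e_i - e_j`, `i < j`. -/
def positiveRoots (n : ℕ) : Set (E n) := {α | ∃ i j : Fin (n + 1), i < j ∧ α = root n i j}

/-- The simple roots `α₁, …, αₙ`; the simple root `α_{i+1} = e_i - e_{i+1}` has index
`i : Fin n`. -/
noncomputable def simpleRoot (n : ℕ) (i : Fin n) : E n := root n i.castSucc i.succ

/-- The highest root `e_0 - e_n = α₁ + ⋯ + αₙ`. -/
noncomputable def highestRoot (n : ℕ) : E n := root n 0 (Fin.last n)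

/-- `ϖ₀ = 0` and the fundamental weights `ϖ₁, …, ϖₙ`, where
`ϖ_i = (e_0 + ⋯ + e_{i-1}) - (i / (n + 1)) (e_0 + ⋯ + e_n)`. -/
noncomputable def fundamentalWeight (n : ℕ) (i : Fin (n + 1)) : E n :=
  ⟨WithLp.toLp 2 fun j : Fin (n + 1) =>
      (if j < i then (1 : ℝ) else 0) - ((i : ℕ) : ℝ) / ((n : ℝ) + 1), by
    have h : ((n : ℝ) + 1) ≠ 0 := by positivity
    simp [E, Finset.sum_sub_distrib, Finset.filter_gt_eq_Iio]
    field_simp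
    ring⟩

/-- The affine Weyl group `W` of type `Ãₙ`: the group of transformations of `E` generated by
the reflections `s_{α,k}`, for roots `α` and integers `k`. -/
def W (n : ℕ) : Subgroup (Equiv.Perm (E n)) :=
  Subgroup.closure {s | ∃ α ∈ roots n, ∃ k : ℤ, s = affineReflection α k}

/-- The fundamental alcove `A_id`, with vertices `0, -ϖ₁, …, -ϖₙ`. -/
def fundamentalAlcove (n : ℕ) : Set (E n) :=
  {v | ∀ α ∈ positiveRoots n, (-1 : ℝ) < inner ℝ α v ∧ inner ℝ α v < 0}

/-- The simple reflections of `W`, that is, the reflections in the walls of the fundamental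
alcove: `s_i = s_{α_i,0}` for `1 ≤ i ≤ n`, and `s_0 = s_{θ,-1}` for the highest root `θ`. -/
def simpleReflections (n : ℕ) : Set (W n) :=
  {s | (∃ i : Fin n, (s : Equiv.Perm (E n)) = affineReflection (simpleRoot n i) 0) ∨
    (s : Equiv.Perm (E n)) = affineReflection (highestRoot n) (-1)}

/-- The alcove `A_x` of an element `x` of `W`. -/
def alcove {n : ℕ} (x : W n) : Set (E n) := (x : Equiv.Perm (E n)) '' fundamentalAlcove n

/-- The (open) dominant chamber `C_+`. -/
def dominantChamber (n : ℕ) : Set (E n) :=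
  {v | ∀ α ∈ positiveRoots n, (0 : ℝ) < inner ℝ α v}

/-- The set `W_+` of dominant elements of `W`. -/
def dominantElements (n : ℕ) : Set (W n) := {x | alcove x ⊆ dominantChamber n}

/-- The cone `ℝ_{≥0} Δ` generated by the simple roots. -/
def simpleCone (n : ℕ) : Set (E n) :=
  {v | ∃ c : Fin n → ℝ, (∀ i, 0 ≤ c i) ∧ v = ∑ i, c i • simpleRoot n i}

/-- The point `x(-ϖ_i)`, a vertex of the alcove of `x`. -/
noncomputable def vertex {n : ℕ} (x : W n) (i : Fin (n + 1)) : E n :=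
  (x : Equiv.Perm (E n)) (-fundamentalWeight n i)

open scoped Pointwise in
/-- The `i`-th parallelotope `(x(-ϖ_i) + ℝ_{≥0} Δ) ∩ (y(-ϖ_i) - ℝ_{≥0} Δ)`. -/
def parallelotope {n : ℕ} (x y : W n) (i : Fin (n + 1)) : Set (E n) :=
  ({vertex x i} + simpleCone n) ∩ ({vertex y i} - simpleCone n)

end AffineA

/-! Write N = n + 1. Extending the coordinates of v ∈ E to ℤ by v_{m+N} = v_m + 1 turns W into a
group of permutations of ℤ commuting with the shift by N (`toPerm`). Reflections become periodic
transpositions of p < q, simple reflections those with q = p + 1, and u → ut is a Bruhat step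
exactly when u(p) < u(q) (`step_iff`). The vertices are read off the window j ↦ u⁻¹(j), 0 ≤ j ≤ n
(`vertex_coord`), and u is dominant iff its window is strictly decreasing.

Both sides of the theorem are compared through `negCount u m` = Σ_j max(0, ⌊(u⁻¹(j) - m)/N⌋). For m
= i + Nc this is Σ_j max(0, p_j - c), where p_j is the integer part of the j-th coordinate of the
i-th vertex. By the Hardy–Littlewood–Pólya criterion, comparing these sums for all c is comparing
partial sums of decreasing vectors, and partial sums are the coefficients in the simple roots. So
for dominant elements the cone conditions are the pointwise order of the counting functions
(`vertex_sub_mem_iff`).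

The Bruhat order implies this order by convexity of max(0, ·) (`negCount_le_of_step`). The converse
for dominant elements (`le_of_negCount_le`) is an induction on the length of y. If y(r) ≥ 0 >
y(r+1), the swap s at r makes ys shorter and still dominant, and counts change only at m ≡ r + 1. If
x has such a sign descent at a translate of r, compare xs with ys and use the lifting property;
otherwise compare x with ys. If y has no sign descent, its counting function is minimal and x = y.
Finally, vertices in the closed chamber force z to be dominant (`mem_dominantElements_of_vertex`).
-/

namespace AffineA

/-! Periodic permutations of `ℤ`. -/

lemma perm_apply_inv_self {α : Type*} (f : Equiv.Perm α) (x : α) : f (f⁻¹ x) = x := by simp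

/-- The transposition of `p + N t` and `q + N t`, for all `t`. -/
def periodicSwap (N p q m : ℤ) : ℤ :=
  if N ∣ m - p then m + (q - p) else if N ∣ m - q then m + (p - q) else m

lemma periodicSwap_left (N p q t : ℤ) : periodicSwap N p q (p + N * t) = q + N * t := by
  have h : N ∣ p + N * t - p := ⟨t, by ring⟩
  simp only [periodicSwap, h, if_true]
  ring

lemma periodicSwap_right {N p q : ℤ} (h : ¬ N ∣ q - p) (t : ℤ) :
    periodicSwap N p q (q + N * t) = p + N * t := by
  have h1 : ¬ N ∣ q + N * t - p := by
    intro h2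
    exact h (by have := dvd_sub h2 (Dvd.intro t rfl : N ∣ N * t); ring_nf at this ⊢; exact this)
  have h2 : N ∣ q + N * t - q := ⟨t, by ring⟩
  simp only [periodicSwap, h1, h2, if_true, if_false]
  ring

lemma periodicSwap_of_not_dvd {N p q m : ℤ} (h : ¬ N ∣ m - p) (h' : ¬ N ∣ m - q) :
    periodicSwap N p q m = m := by
  simp [periodicSwap, h, h']

/-- Case distinction for the value of a periodic transposition. -/
lemma periodicSwap_cases {N p q : ℤ} (h : ¬ N ∣ q - p) (m : ℤ) :
    (∃ t, m = p + N * t ∧ periodicSwap N p q m = q + N * t) ∨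
    (∃ t, m = q + N * t ∧ periodicSwap N p q m = p + N * t) ∨
    (¬ N ∣ m - p ∧ ¬ N ∣ m - q ∧ periodicSwap N p q m = m) := by
  by_cases h1 : N ∣ m - p
  · obtain ⟨t, ht⟩ := h1
    obtain rfl : m = p + N * t := by linarith
    exact Or.inl ⟨t, rfl, periodicSwap_left ..⟩
  by_cases h2 : N ∣ m - q
  · obtain ⟨t, ht⟩ := h2
    obtain rfl : m = q + N * t := by linarith
    exact Or.inr (Or.inl ⟨t, rfl, periodicSwap_right h t⟩)
  · exact Or.inr (Or.inr ⟨h1, h2, periodicSwap_of_not_dvd h1 h2⟩)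

lemma periodicSwap_involutive {N p q : ℤ} (h : ¬ N ∣ q - p) :
    Function.Involutive (periodicSwap N p q) := by
  intro m
  rcases periodicSwap_cases h m with ⟨t, h1, h2⟩ | ⟨t, h1, h2⟩ | ⟨-, -, h2⟩
  · rw [h2, periodicSwap_right h, h1]
  · rw [h2, periodicSwap_left, h1]
  · rw [h2, h2]

lemma periodicSwap_add_period (N p q m : ℤ) :
    periodicSwap N p q (m + N) = periodicSwap N p q m + N := by
  have h (x : ℤ) : N ∣ m + N - x ↔ N ∣ m - x := by
    rw [show m + N - x = m - x + N by ring, dvd_add_self_right]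
  simp only [periodicSwap, h]
  split_ifs <;> ring

lemma periodicSwap_comm {N p q : ℤ} (h : ¬ N ∣ q - p) :
    periodicSwap N q p = periodicSwap N p q := by
  have h' : ¬ N ∣ p - q := by rwa [← dvd_neg, neg_sub]
  funext m
  rcases periodicSwap_cases h m with ⟨t, rfl, h2⟩ | ⟨t, rfl, h2⟩ | ⟨h1, h3, h2⟩
  · rw [h2, periodicSwap_right h']
  · rw [h2, periodicSwap_left]
  · rw [h2, periodicSwap_of_not_dvd h3 h1]

lemma periodicSwap_shift (N p q t : ℤ) :
    periodicSwap N (p + N * t) (q + N * t) = periodicSwap N p q := by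
  have h (m x : ℤ) : N ∣ m - (x + N * t) ↔ N ∣ m - x := by
    rw [show m - (x + N * t) = m - x - N * t by ring]
    exact dvd_sub_left (Dvd.intro t rfl)
  funext m
  simp only [periodicSwap, h]
  ring_nf

/-- A permutation of `ℤ` commuting with the shift by `N`. -/
def IsPeriodicPerm (N : ℤ) (f : Equiv.Perm ℤ) : Prop := ∀ m, f (m + N) = f m + N

namespace IsPeriodicPerm

variable {N : ℤ} {f g : Equiv.Perm ℤ}

lemma one : IsPeriodicPerm N 1 := fun _ => rfl

lemma mul (hf : IsPeriodicPerm N f) (hg : IsPeriodicPerm N g) : IsPeriodicPerm N (f * g) := by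
  intro m
  simp [hg m, hf (g m)]

lemma inv (hf : IsPeriodicPerm N f) : IsPeriodicPerm N f⁻¹ := by
  intro m
  rw [Equiv.Perm.inv_eq_iff_eq, hf, perm_apply_inv_self]

lemma apply_add_mul (hf : IsPeriodicPerm N f) (m t : ℤ) : f (m + N * t) = f m + N * t := by
  induction t using Int.induction_on with
  | zero => simp
  | succ k ih =>
    rw [show m + N * ((k : ℤ) + 1) = m + N * k + N by ring, hf, ih]
    ring
  | pred k ih =>
    have := hf (m + N * (-(k : ℤ) - 1))
    rw [show m + N * (-(k : ℤ) - 1) + N = m + N * -k by ring, ih] at this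
    linarith

lemma dvd_sub_iff (hf : IsPeriodicPerm N f) (a b : ℤ) : N ∣ f a - f b ↔ N ∣ a - b := by
  constructor
  · rintro ⟨t, ht⟩
    have : f a = f (b + N * t) := by rw [hf.apply_add_mul]; linarith
    exact ⟨t, by rw [f.injective this]; ring⟩
  · rintro ⟨t, ht⟩
    exact ⟨t, by rw [show a = b + N * t by linarith, hf.apply_add_mul]; ring⟩

lemma apply_periodicSwap (hf : IsPeriodicPerm N f) {p q : ℤ} (h : ¬ N ∣ q - p) (m : ℤ) :
    f (periodicSwap N p q m) = periodicSwap N (f p) (f q) (f m) := by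
  have h' : ¬ N ∣ f q - f p := by rwa [hf.dvd_sub_iff]
  rcases periodicSwap_cases h m with ⟨t, h1, h2⟩ | ⟨t, h1, h2⟩ | ⟨h1, h3, h2⟩
  · rw [h2, h1, hf.apply_add_mul, hf.apply_add_mul, periodicSwap_left]
  · rw [h2, h1, hf.apply_add_mul, hf.apply_add_mul, periodicSwap_right h']
  · rw [h2, periodicSwap_of_not_dvd] <;> rwa [hf.dvd_sub_iff]

end IsPeriodicPerm

/-! The periodic extension of a vector. -/

variable {n : ℕ}

/-- The residue of an integer modulo `n + 1`, as a coordinate index. -/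
def residue (n : ℕ) (m : ℤ) : Fin (n + 1) :=
  ⟨(m % ((n : ℤ) + 1)).toNat, by
    have h1 := Int.emod_nonneg m (show ((n : ℤ) + 1) ≠ 0 by positivity)
    have h2 := Int.emod_lt_of_pos m (show (0 : ℤ) < (n : ℤ) + 1 by positivity)
    omega⟩

lemma residue_add_ediv (n : ℕ) (m : ℤ) :
    ((residue n m : ℕ) : ℤ) + ((n : ℤ) + 1) * (m / ((n : ℤ) + 1)) = m := by
  have h1 := Int.emod_nonneg m (show ((n : ℤ) + 1) ≠ 0 by positivity)
  have h2 := Int.emod_add_mul_ediv m ((n : ℤ) + 1)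
  simp only [residue]
  rw [Int.toNat_of_nonneg h1, h2]

lemma exists_fin_add_mul (n : ℕ) (m : ℤ) :
    ∃ (j : Fin (n + 1)) (t : ℤ), m = ((j : ℕ) : ℤ) + ((n : ℤ) + 1) * t :=
  ⟨_, _, (residue_add_ediv n m).symm⟩

lemma ediv_fin_add_mul (j : Fin (n + 1)) (t : ℤ) :
    (((j : ℕ) : ℤ) + ((n : ℤ) + 1) * t) / ((n : ℤ) + 1) = t := by
  have h := j.isLt
  rw [Int.add_mul_ediv_left _ _ (by positivity), Int.ediv_eq_zero_of_lt (by positivity) (by omega),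
    zero_add]

lemma residue_fin_add_mul (j : Fin (n + 1)) (t : ℤ) :
    residue n (((j : ℕ) : ℤ) + ((n : ℤ) + 1) * t) = j := by
  have h := residue_add_ediv n (((j : ℕ) : ℤ) + ((n : ℤ) + 1) * t)
  rw [ediv_fin_add_mul] at h
  ext
  omega

/-- The extension of the coordinates of `v` to `ℤ` with `lift v (m + (n + 1)) = lift v m + 1`. -/
noncomputable def lift (v : E n) (m : ℤ) : ℝ :=
  v.1 (residue n m) + ((m / ((n : ℤ) + 1) : ℤ) : ℝ)

lemma lift_fin_add_mul (v : E n) (j : Fin (n + 1)) (t : ℤ) :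
    lift v (((j : ℕ) : ℤ) + ((n : ℤ) + 1) * t) = v.1 j + t := by
  rw [lift, ediv_fin_add_mul, residue_fin_add_mul]

lemma lift_fin (v : E n) (j : Fin (n + 1)) : lift v ((j : ℕ) : ℤ) = v.1 j := by
  simpa using lift_fin_add_mul v j 0

lemma lift_injective : Function.Injective (lift : E n → ℤ → ℝ) := by
  intro v w h
  ext j
  rw [← lift_fin, ← lift_fin, h]

/-- A point of the fundamental alcove. -/
noncomputable def alcovePoint (n : ℕ) : E n :=
  ⟨WithLp.toLp 2 fun j : Fin (n + 1) =>
      ((j : ℕ) : ℝ) / ((n : ℝ) + 1) - (n : ℝ) / (2 * ((n : ℝ) + 1)), by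
    have h : ((n : ℝ) + 1) ≠ 0 := by positivity
    have h2 : ∑ j : Fin (n + 1), ((j : ℕ) : ℝ) = n * (n + 1) / 2 := by
      rw [Fin.sum_univ_eq_sum_range (fun j => (j : ℝ))]
      induction n with
      | zero => simp
      | succ k ih =>
        rw [Finset.sum_range_succ, ih (by positivity)]
        push_cast
        ring
    simp only [E, Submodule.mem_mk, AddSubmonoid.mem_mk, AddSubsemigroup.mem_mk,
      Set.mem_ofPred_eq, Finset.sum_sub_distrib, ← Finset.sum_div, h2]
    simp
    field_simp
    ring⟩

lemma lift_alcovePoint (m : ℤ) :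
    lift (alcovePoint n) m = (m : ℝ) / ((n : ℝ) + 1) - (n : ℝ) / (2 * ((n : ℝ) + 1)) := by
  obtain ⟨j, t, rfl⟩ := exists_fin_add_mul n m
  have h : ((n : ℝ) + 1) ≠ 0 := by positivity
  rw [lift_fin_add_mul]
  simp only [alcovePoint]
  push_cast
  field_simp
  ring

/-- The extended coordinates of `alcovePoint` form an arithmetic progression, so this one point
separates all integers. This makes the permutation attached to u unique, and `toPerm`
multiplicative. -/
lemma eq_of_forall_lift_eq {a b : ℤ} (h : ∀ v : E n, lift v a = lift v b) : a = b := by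
  have h1 := h (alcovePoint n)
  have h2 : ((n : ℝ) + 1) ≠ 0 := by positivity
  rw [lift_alcovePoint, lift_alcovePoint] at h1
  field_simp at h1
  exact_mod_cast (by linarith : (a : ℝ) = b)

lemma inner_root (i j : Fin (n + 1)) (v : E n) : inner ℝ (root n i j) v = v.1 i - v.1 j := by
  simp [root, Submodule.coe_inner, inner_sub_left, EuclideanSpace.inner_single_left]

lemma affineReflection_root_apply {i j : Fin (n + 1)} (h : i ≠ j) (k : ℤ) (v : E n)
    (l : Fin (n + 1)) :
    (affineReflection (root n i j) k v).1 l =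
      v.1 l - (v.1 i - v.1 j - k) * ((if l = i then 1 else 0) - if l = j then 1 else 0) := by
  have h1 : inner ℝ (root n i j) (root n i j) = (2 : ℝ) := by
    rw [inner_root]
    simp [root, h, h.symm]
    norm_num
  have h2 : affineReflection (root n i j) k v =
      v - (2 * (inner ℝ (root n i j) v - (k : ℝ)) / inner ℝ (root n i j) (root n i j)) •
        root n i j := rfl
  rw [h2, h1, inner_root]
  simp [root, PiLp.single_apply]

lemma not_dvd_root {i j : Fin (n + 1)} (h : i ≠ j) (k : ℤ) :
    ¬ ((n : ℤ) + 1) ∣ ((j : ℕ) : ℤ) + ((n : ℤ) + 1) * k - ((i : ℕ) : ℤ) := by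
  rintro ⟨t, ht⟩
  have h1 := residue_fin_add_mul j k
  rw [show ((j : ℕ) : ℤ) + ((n : ℤ) + 1) * k = ((i : ℕ) : ℤ) + ((n : ℤ) + 1) * t by linarith,
    residue_fin_add_mul] at h1
  exact h h1

/-! ### The action of W on ℤ -/

/-- `f` describes the action of `u` on the extended coordinates. -/
def IsLift (u : Equiv.Perm (E n)) (f : Equiv.Perm ℤ) : Prop :=
  IsPeriodicPerm ((n : ℤ) + 1) f ∧ ∀ v m, lift (u v) (f m) = lift v m

/-- The reflection replaces v_i by v_j + k, which is the extended coordinate at j + Nk; so it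
exchanges the positions i and j + Nk. -/
lemma isLift_affineReflection {i j : Fin (n + 1)} (h : i ≠ j) (k : ℤ) :
    IsLift (affineReflection (root n i j) k)
      (periodicSwap_involutive (not_dvd_root h k)).toPerm := by
  refine ⟨fun m => periodicSwap_add_period _ _ _ m, fun v m => ?_⟩
  obtain ⟨l, t, rfl⟩ := exists_fin_add_mul n m
  simp only [Function.Involutive.coe_toPerm]
  by_cases hi : l = i
  · subst hi
    rw [periodicSwap_left, add_assoc, ← mul_add, lift_fin_add_mul, lift_fin_add_mul,
      affineReflection_root_apply h, if_pos rfl, if_neg h.symm]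
    push_cast
    ring
  by_cases hj : l = j
  · subst hj
    rw [show ((l : ℕ) : ℤ) + ((n : ℤ) + 1) * t =
      ((l : ℕ) : ℤ) + ((n : ℤ) + 1) * k + ((n : ℤ) + 1) * (t - k) by ring,
      periodicSwap_right (not_dvd_root h k), add_assoc, ← mul_add, lift_fin_add_mul,
      lift_fin_add_mul, affineReflection_root_apply h, if_pos rfl, if_neg h]
    push_cast
    ring
  · rw [periodicSwap_of_not_dvd, lift_fin_add_mul, lift_fin_add_mul,
      affineReflection_root_apply h]
    · simp [hi, hj]
    · exact not_dvd_root (Ne.symm hi) t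
    · intro hd
      refine not_dvd_root (Ne.symm hj) (t - k) ?_
      convert hd using 1
      ring

lemma IsLift.one : IsLift (1 : Equiv.Perm (E n)) 1 :=
  ⟨IsPeriodicPerm.one, fun _ _ => rfl⟩

lemma IsLift.mul {u u' : Equiv.Perm (E n)} {f f' : Equiv.Perm ℤ} (h : IsLift u f)
    (h' : IsLift u' f') : IsLift (u * u') (f * f') :=
  ⟨h.1.mul h'.1, fun v m => by simp [h.2, h'.2]⟩

lemma IsLift.inv {u : Equiv.Perm (E n)} {f : Equiv.Perm ℤ} (h : IsLift u f) : IsLift u⁻¹ f⁻¹ :=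
  ⟨h.1.inv, fun v m => by rw [← h.2]; simp⟩

lemma IsLift.unique {u : Equiv.Perm (E n)} {f f' : Equiv.Perm ℤ} (h : IsLift u f)
    (h' : IsLift u f') : f = f' := by
  ext m
  refine eq_of_forall_lift_eq (n := n) fun w => ?_
  have h1 := h.2 (u⁻¹ w) m
  have h2 := h'.2 (u⁻¹ w) m
  rw [perm_apply_inv_self] at h1 h2
  rw [h1, h2]

lemma exists_isLift {u : Equiv.Perm (E n)} (hu : u ∈ W n) : ∃ f, IsLift u f := by
  refine Subgroup.closure_induction (p := fun u _ => ∃ f, IsLift u f) ?_ ?_ ?_ ?_ hu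
  · rintro _ ⟨_, ⟨i, j, h, rfl⟩, k, rfl⟩
    exact ⟨_, isLift_affineReflection h k⟩
  · exact ⟨1, IsLift.one⟩
  · rintro x y - - ⟨f, hf⟩ ⟨g, hg⟩
    exact ⟨_, hf.mul hg⟩
  · rintro x - ⟨f, hf⟩
    exact ⟨_, hf.inv⟩

/-- The affine Weyl group as a group of permutations of `ℤ`. -/
noncomputable def toPerm (n : ℕ) : W n →* Equiv.Perm ℤ :=
  MonoidHom.mk' (fun u => (exists_isLift u.2).choose) fun u u' =>
    (exists_isLift (u * u').2).choose_spec.unique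
      ((exists_isLift u.2).choose_spec.mul (exists_isLift u'.2).choose_spec)

lemma isLift_toPerm (u : W n) : IsLift u.1 (toPerm n u) := (exists_isLift u.2).choose_spec

lemma isPeriodicPerm_toPerm (u : W n) : IsPeriodicPerm ((n : ℤ) + 1) (toPerm n u) :=
  (isLift_toPerm u).1

lemma toPerm_injective : Function.Injective (toPerm n) := by
  intro u u' h
  ext1
  ext1 v
  apply lift_injective
  funext m
  have h1 := (isLift_toPerm u).2 v ((toPerm n u)⁻¹ m)
  have h2 := (isLift_toPerm u').2 v ((toPerm n u)⁻¹ m)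
  rw [← h] at h2
  rw [perm_apply_inv_self] at h1 h2
  rw [h1, h2]

lemma apply_coord (u : W n) (v : E n) (j : Fin (n + 1)) :
    (u.1 v).1 j = lift v ((toPerm n u)⁻¹ ((j : ℕ) : ℤ)) := by
  rw [← (isLift_toPerm u).2, perm_apply_inv_self, lift_fin]

/-! Simple reflections, reflections and generation. -/

lemma toPerm_affineReflection {i j : Fin (n + 1)} (h : i ≠ j) (k : ℤ) (t : W n)
    (ht : t.1 = affineReflection (root n i j) k) :
    ⇑(toPerm n t) =
      periodicSwap ((n : ℤ) + 1) ((i : ℕ) : ℤ) (((j : ℕ) : ℤ) + ((n : ℤ) + 1) * k) := by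
  have h1 := isLift_toPerm t
  rw [ht] at h1
  rw [h1.unique (isLift_affineReflection h k)]
  rfl

lemma exists_affineReflection {p q : ℤ} (h : ¬ ((n : ℤ) + 1) ∣ q - p) :
    ∃ (i j : Fin (n + 1)) (k : ℤ), i ≠ j ∧
      ∀ t : W n, t.1 = affineReflection (root n i j) k →
        ⇑(toPerm n t) = periodicSwap ((n : ℤ) + 1) p q := by
  obtain ⟨i, s, rfl⟩ := exists_fin_add_mul n p
  obtain ⟨j, s', rfl⟩ := exists_fin_add_mul n q
  have hij : i ≠ j := by
    rintro rfl
    exact h ⟨s' - s, by ring⟩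
  refine ⟨i, j, s' - s, hij, fun t ht => ?_⟩
  rw [toPerm_affineReflection hij _ t ht, ← periodicSwap_shift _ _ _ s]
  congr 1
  ring

lemma exists_toPerm_eq_periodicSwap {p q : ℤ} (h : ¬ ((n : ℤ) + 1) ∣ q - p) :
    ∃ t : W n, ⇑(toPerm n t) = periodicSwap ((n : ℤ) + 1) p q := by
  obtain ⟨i, j, k, hij, ht⟩ := exists_affineReflection h
  exact ⟨⟨affineReflection (root n i j) k,
    Subgroup.subset_closure ⟨_, ⟨i, j, hij, rfl⟩, k, rfl⟩⟩, ht _ rfl⟩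

lemma not_dvd_succ (hn : 1 ≤ n) (r : ℤ) : ¬ ((n : ℤ) + 1) ∣ r + 1 - r := by
  intro h
  rw [show r + 1 - r = 1 by ring] at h
  have := Int.le_of_dvd one_pos h
  omega

lemma toPerm_ext {u w : W n} (h : ∀ m, toPerm n u m = toPerm n w m) : u = w :=
  toPerm_injective (Equiv.ext h)

lemma mul_self_of_periodicSwap {p q : ℤ} (h : ¬ ((n : ℤ) + 1) ∣ q - p)
    {t : W n} (ht : ⇑(toPerm n t) = periodicSwap ((n : ℤ) + 1) p q) : t * t = 1 := by
  refine toPerm_ext fun m => ?_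
  rw [map_mul, Equiv.Perm.mul_apply, ht, periodicSwap_involutive h]
  simp

/-- The walls of the simple roots give the adjacent pairs inside one period. The wall of the highest
root at level -1 pairs 0 with n - N = -1, the adjacent pair across the period boundary. -/
lemma mem_simpleReflections_iff (hn : 1 ≤ n) (s : W n) :
    s ∈ simpleReflections n ↔ ∃ r, ⇑(toPerm n s) = periodicSwap ((n : ℤ) + 1) r (r + 1) := by
  have h0 : (0 : Fin (n + 1)) ≠ Fin.last n := by
    rw [Ne, Fin.ext_iff]
    simp
    omega
  constructor
  · rintro (⟨i, hi⟩ | hs)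
    · refine ⟨(i : ℕ), ?_⟩
      rw [toPerm_affineReflection (Fin.castSucc_lt_succ).ne _ s hi]
      simp
    · refine ⟨-1, ?_⟩
      rw [toPerm_affineReflection h0 _ s hs, periodicSwap_comm]
      · simp
      · have := not_dvd_succ hn (-1)
        simpa using this
  · rintro ⟨r, hr⟩
    obtain ⟨j, t, rfl⟩ := exists_fin_add_mul n r
    by_cases hj : (j : ℕ) < n
    · left
      refine ⟨⟨j, hj⟩, ?_⟩
      let s' : W n := ⟨affineReflection (simpleRoot n ⟨j, hj⟩) 0,
        Subgroup.subset_closure ⟨_, ⟨_, _, (Fin.castSucc_lt_succ).ne, rfl⟩, 0, rfl⟩⟩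
      suffices s = s' from congrArg Subtype.val this
      refine toPerm_injective (DFunLike.coe_injective ?_)
      rw [hr, toPerm_affineReflection (Fin.castSucc_lt_succ).ne 0 s' rfl,
        add_right_comm, periodicSwap_shift]
      simp
    · right
      let s' : W n := ⟨affineReflection (highestRoot n) (-1),
        Subgroup.subset_closure ⟨_, ⟨_, _, h0, rfl⟩, -1, rfl⟩⟩
      suffices s = s' from congrArg Subtype.val this
      refine toPerm_injective (DFunLike.coe_injective ?_)
      have hjn : ((j : ℕ) : ℤ) = n := by have := j.isLt; omega
      rw [hr, toPerm_affineReflection h0 (-1) s' rfl, hjn,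
        show (n : ℤ) + ((n : ℤ) + 1) * t + 1 = 0 + ((n : ℤ) + 1) * (t + 1) by ring,
        show (n : ℤ) + ((n : ℤ) + 1) * t = -1 + ((n : ℤ) + 1) * (t + 1) by ring,
        periodicSwap_shift, ← periodicSwap_comm (not_dvd_root h0 (-1))]
      simp

lemma toPerm_conj {p q : ℤ} (h : ¬ ((n : ℤ) + 1) ∣ q - p) {t : W n}
    (ht : ⇑(toPerm n t) = periodicSwap ((n : ℤ) + 1) p q) (u : W n) :
    ⇑(toPerm n (u * t * u⁻¹)) =
      periodicSwap ((n : ℤ) + 1) (toPerm n u p) (toPerm n u q) := by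
  funext m
  rw [map_mul, map_mul, map_inv, Equiv.Perm.mul_apply, Equiv.Perm.mul_apply, ht,
    (isPeriodicPerm_toPerm u).apply_periodicSwap h, perm_apply_inv_self]

lemma not_dvd_toPerm {p q : ℤ} (h : ¬ ((n : ℤ) + 1) ∣ q - p) (u : W n) :
    ¬ ((n : ℤ) + 1) ∣ toPerm n u q - toPerm n u p := by
  rwa [(isPeriodicPerm_toPerm u).dvd_sub_iff]

/-- Conjugating by the swap of q - 1 and q lowers q by one and does not lower p, so the gap q - p
shrinks until the pair is adjacent. -/
lemma exists_conj_simpleReflection (hn : 1 ≤ n) (k : ℕ) (p q : ℤ) (hk : q - p ≤ k) (hpq : p < q)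
    (h : ¬ ((n : ℤ) + 1) ∣ q - p) (t : W n)
    (ht : ⇑(toPerm n t) = periodicSwap ((n : ℤ) + 1) p q) :
    ∃ w ∈ Subgroup.closure (simpleReflections n), ∃ s ∈ simpleReflections n,
      t = w * s * w⁻¹ := by
  induction k generalizing p q t with
  | zero => push_cast at hk; omega
  | succ k ih =>
    by_cases h1 : q = p + 1
    · subst h1
      exact ⟨1, one_mem _, t, (mem_simpleReflections_iff hn t).2 ⟨p, ht⟩, by simp⟩
    obtain ⟨s, hs⟩ := exists_toPerm_eq_periodicSwap (not_dvd_succ hn (q - 1))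
    have hsS : s ∈ simpleReflections n := (mem_simpleReflections_iff hn s).2 ⟨_, hs⟩
    have hc := toPerm_conj h ht s
    have hd := not_dvd_toPerm h s
    have hq : toPerm n s q = q - 1 := by
      rw [hs]
      simpa using periodicSwap_right (not_dvd_succ hn (q - 1)) 0
    have hp : p ≤ toPerm n s p ∧ toPerm n s p < q - 1 := by
      rw [hs]
      rcases periodicSwap_cases (not_dvd_succ hn (q - 1)) p with
        ⟨t', h2, h3⟩ | ⟨t', h2, -⟩ | ⟨-, -, h3⟩
      · rw [h3]
        -- Since p is congruent to q - 1 but smaller, it is at least a full period below, so p + 1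
        -- is still less than q - 1.
        have : t' < 0 := by
          by_contra h4
          have : 0 ≤ ((n : ℤ) + 1) * t' := mul_nonneg (by positivity) (by omega)
          omega
        have : ((n : ℤ) + 1) * t' ≤ ((n : ℤ) + 1) * (-1) :=
          mul_le_mul_of_nonneg_left (by omega) (by positivity)
        omega
      · exact absurd ⟨-t', by rw [h2]; ring⟩ h
      · rw [h3]
        omega
    rw [hq] at hc hd
    obtain ⟨w, hw, s', hs', he⟩ := ih (toPerm n s p) (q - 1) (by push_cast at hk; omega)
      hp.2 hd _ hc
    refine ⟨s⁻¹ * w, mul_mem (inv_mem (Subgroup.subset_closure hsS)) hw, s', hs', ?_⟩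
    calc t = s⁻¹ * (s * t * s⁻¹) * s := by group
      _ = _ := by rw [he]; group

lemma isReflection_iff (hn : 1 ≤ n) (t : W n) :
    Bruhat.IsReflection (simpleReflections n) t ↔
      ∃ p q, p < q ∧ ¬ ((n : ℤ) + 1) ∣ q - p ∧
        ⇑(toPerm n t) = periodicSwap ((n : ℤ) + 1) p q := by
  constructor
  · rintro ⟨w, s, hs, rfl⟩
    obtain ⟨r, hr⟩ := (mem_simpleReflections_iff hn s).1 hs
    have h1 := toPerm_conj (not_dvd_succ hn r) hr w
    have h2 := not_dvd_toPerm (not_dvd_succ hn r) w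
    rcases lt_trichotomy (toPerm n w r) (toPerm n w (r + 1)) with h | h | h
    · exact ⟨_, _, h, h2, h1⟩
    · rw [h, sub_self] at h2
      exact absurd (dvd_zero _) h2
    · refine ⟨_, _, h, ?_, h1.trans (periodicSwap_comm h2).symm⟩
      rwa [← dvd_neg, neg_sub]
  · rintro ⟨p, q, hpq, h, ht⟩
    obtain ⟨w, -, s, hs, rfl⟩ := exists_conj_simpleReflection hn (q - p).toNat p q
      (by omega) hpq h t ht
    exact ⟨w, s, hs, rfl⟩

lemma closure_simpleReflections (hn : 1 ≤ n) : Subgroup.closure (simpleReflections n) = ⊤ := by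
  rw [eq_top_iff]
  have key : ∀ u (hu : u ∈ W n), (⟨u, hu⟩ : W n) ∈ Subgroup.closure (simpleReflections n) := by
    intro u hu
    refine Subgroup.closure_induction
      (p := fun u hu => (⟨u, hu⟩ : W n) ∈ Subgroup.closure (simpleReflections n)) ?_ ?_ ?_ ?_ hu
    · rintro _ ⟨_, ⟨i, j, hij, rfl⟩, k, rfl⟩
      set t : W n := ⟨affineReflection (root n i j) k,
        Subgroup.subset_closure ⟨_, ⟨i, j, hij, rfl⟩, k, rfl⟩⟩ with htdef
      have ht := toPerm_affineReflection hij k t rfl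
      have hd := not_dvd_root hij k
      have hr : ∃ p q, p < q ∧ ¬ ((n : ℤ) + 1) ∣ q - p ∧
          ⇑(toPerm n t) = periodicSwap ((n : ℤ) + 1) p q := by
        rcases lt_trichotomy ((i : ℕ) : ℤ) (((j : ℕ) : ℤ) + ((n : ℤ) + 1) * k) with h | h | h
        · exact ⟨_, _, h, hd, ht⟩
        · rw [← h, sub_self] at hd
          exact absurd (dvd_zero _) hd
        · refine ⟨_, _, h, ?_, ht.trans (periodicSwap_comm hd).symm⟩
          rwa [← dvd_neg, neg_sub]
      obtain ⟨p, q, hpq, hd', ht'⟩ := hr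
      obtain ⟨w, hw, s, hs, he⟩ := exists_conj_simpleReflection hn (q - p).toNat p q
        (by omega) hpq hd' t ht'
      rw [he]
      exact mul_mem (mul_mem hw (Subgroup.subset_closure hs)) (inv_mem hw)
    · exact one_mem _
    · intro x y hx hy h1 h2
      exact mul_mem h1 h2
    · intro x hx h1
      exact inv_mem h1
  exact fun u _ => key u.1 u.2

/-! Length and the Bruhat order. -/

lemma simpleReflections_mul_self (hn : 1 ≤ n) {s : W n} (hs : s ∈ simpleReflections n) :
    s * s = 1 := by
  obtain ⟨r, hr⟩ := (mem_simpleReflections_iff hn s).1 hs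
  exact mul_self_of_periodicSwap (not_dvd_succ hn r) hr

lemma exists_reduced_word (hn : 1 ≤ n) (w : W n) :
    ∃ l : List (W n), (∀ s ∈ l, s ∈ simpleReflections n) ∧ l.prod = w ∧
      l.length = Bruhat.length (simpleReflections n) w := by
  refine Nat.sInf_mem (s := {k : ℕ | ∃ l : List (W n), (∀ s ∈ l, s ∈ simpleReflections n) ∧
    l.prod = w ∧ l.length = k}) ?_
  have hw : w ∈ Subgroup.closure (simpleReflections n) := by
    rw [closure_simpleReflections hn]
    trivial
  rw [← Subgroup.mem_toSubmonoid, Subgroup.closure_toSubmonoid] at hw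
  obtain ⟨l, hl, rfl⟩ := Submonoid.exists_list_of_mem_closure hw
  refine ⟨l.length, l, fun s hs => ?_, rfl, rfl⟩
  rcases hl s hs with h | h
  · exact h
  · rwa [Set.mem_inv, inv_eq_of_mul_eq_one_left (b := s)
      (by simpa using congrArg Inv.inv (simpleReflections_mul_self hn h))] at h

lemma length_le_of_word {w : W n} {l : List (W n)} (hl : ∀ s ∈ l, s ∈ simpleReflections n)
    (hw : l.prod = w) : Bruhat.length (simpleReflections n) w ≤ l.length :=
  Nat.sInf_le ⟨l, hl, hw, rfl⟩

/-- The strong exchange property. -/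
lemma exists_shorter_word (hn : 1 ≤ n) {p q : ℤ} (hpq : p < q) (h : ¬ ((n : ℤ) + 1) ∣ q - p)
    {t : W n} (ht : ⇑(toPerm n t) = periodicSwap ((n : ℤ) + 1) p q) (l : List (W n))
    (hl : ∀ s ∈ l, s ∈ simpleReflections n) (hinv : toPerm n l.prod q < toPerm n l.prod p) :
    ∃ l' : List (W n), (∀ s ∈ l', s ∈ simpleReflections n) ∧ l'.prod = l.prod * t ∧
      l'.length < l.length := by
  induction l with
  | nil => simp at hinv; omega
  | cons s l ih =>
    have hs := hl s (by simp)
    have hl' : ∀ s ∈ l, s ∈ simpleReflections n := fun x hx => hl x (by simp [hx])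
    by_cases h1 : toPerm n l.prod q < toPerm n l.prod p
    · obtain ⟨l', h2, h3, h4⟩ := ih hl' h1
      refine ⟨s :: l', ?_, by rw [List.prod_cons, h3, List.prod_cons, mul_assoc], by simpa using h4⟩
      simpa [hs] using h2
    · refine ⟨l, hl', ?_, by simp⟩
      obtain ⟨r, hr⟩ := (mem_simpleReflections_iff hn s).1 hs
      have h2 := not_dvd_toPerm h l.prod
      have hlt : toPerm n l.prod p < toPerm n l.prod q := by
        rcases lt_trichotomy (toPerm n l.prod p) (toPerm n l.prod q) with h3 | h3 | h3
        · exact h3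
        · rw [h3, sub_self] at h2
          exact absurd (dvd_zero _) h2
        · exact absurd h3 h1
      rw [List.prod_cons, map_mul, Equiv.Perm.mul_apply, Equiv.Perm.mul_apply, hr] at hinv
      -- The letter s reverses the order of the two images only if they are r + Na and r + 1 + Na
      -- for one a; then `l.prod` conjugates t into s, and deleting s amounts to multiplying by t.
      have hconj : l.prod * t * l.prod⁻¹ = s := by
        refine toPerm_injective (DFunLike.coe_injective ?_)
        rw [toPerm_conj h ht, hr]
        rcases periodicSwap_cases (not_dvd_succ hn r) (toPerm n l.prod p) with
          ⟨a, h3, h4⟩ | ⟨a, h3, h4⟩ | ⟨-, -, h4⟩ <;>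
        rcases periodicSwap_cases (not_dvd_succ hn r) (toPerm n l.prod q) with
          ⟨b, h5, h6⟩ | ⟨b, h5, h6⟩ | ⟨-, -, h6⟩ <;> rw [h4, h6] at hinv
        · omega
        · rw [h3, h5, show r + 1 + ((n : ℤ) + 1) * b = r + 1 + ((n : ℤ) + 1) * a by omega,
            periodicSwap_shift]
        · omega
        · omega
        · omega
        · omega
        · omega
        · omega
        · omega
      rw [List.prod_cons, ← hconj]
      calc l.prod = l.prod * (t * t) := by rw [mul_self_of_periodicSwap h ht, mul_one]
        _ = _ := by group

lemma length_mul_lt (hn : 1 ≤ n) {p q : ℤ} (hpq : p < q) (h : ¬ ((n : ℤ) + 1) ∣ q - p)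
    {t : W n} (ht : ⇑(toPerm n t) = periodicSwap ((n : ℤ) + 1) p q) {w : W n}
    (hinv : toPerm n w q < toPerm n w p) :
    Bruhat.length (simpleReflections n) (w * t) < Bruhat.length (simpleReflections n) w := by
  obtain ⟨l, hl, rfl, hlen⟩ := exists_reduced_word hn w
  obtain ⟨l', h1, h2, h3⟩ := exists_shorter_word hn hpq h ht l hl hinv
  rw [← hlen]
  exact (length_le_of_word h1 h2).trans_lt h3

/-- `u → w` is detected by an inversion. -/
lemma step_iff (hn : 1 ≤ n) (u w : W n) :
    Bruhat.Step (simpleReflections n) u w ↔ ∃ (t : W n) (p q : ℤ), p < q ∧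
      ¬ ((n : ℤ) + 1) ∣ q - p ∧ ⇑(toPerm n t) = periodicSwap ((n : ℤ) + 1) p q ∧ w = u * t ∧
        toPerm n u p < toPerm n u q := by
  constructor
  · rintro ⟨t, htr, rfl, hlen⟩
    obtain ⟨p, q, hpq, h, ht⟩ := (isReflection_iff hn t).1 htr
    refine ⟨t, p, q, hpq, h, ht, rfl, ?_⟩
    have h2 := not_dvd_toPerm h u
    rcases lt_trichotomy (toPerm n u p) (toPerm n u q) with h3 | h3 | h3
    · exact h3
    · rw [h3, sub_self] at h2
      exact absurd (dvd_zero _) h2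
    · exact absurd (length_mul_lt hn hpq h ht h3) hlen.asymm
  · rintro ⟨t, p, q, hpq, h, ht, rfl, hu⟩
    refine ⟨t, (isReflection_iff hn t).2 ⟨p, q, hpq, h, ht⟩, rfl, ?_⟩
    have h1 := length_mul_lt hn hpq h ht (w := u * t) (by
      have hp := periodicSwap_left ((n : ℤ) + 1) p q 0
      have hq := periodicSwap_right h 0
      simp only [mul_zero, add_zero] at hp hq
      rwa [map_mul, Equiv.Perm.mul_apply, Equiv.Perm.mul_apply, ht, hp, hq])
    rwa [mul_assoc, mul_self_of_periodicSwap h ht, mul_one] at h1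

/-- The lifting property of a single step. -/
lemma step_mul_simpleReflection (hn : 1 ≤ n) {u w s : W n} (hs : s ∈ simpleReflections n)
    (h : Bruhat.Step (simpleReflections n) u w) :
    u * s = w ∨ Bruhat.Step (simpleReflections n) (u * s) (w * s) := by
  obtain ⟨t, p, q, hpq, hd, ht, rfl, hu⟩ := (step_iff hn u w).1 h
  by_cases hst : s = t
  · exact Or.inl (by rw [hst])
  right
  have hss := simpleReflections_mul_self hn hs
  have hsi : s⁻¹ = s := inv_eq_of_mul_eq_one_left hss
  obtain ⟨r, hr⟩ := (mem_simpleReflections_iff hn s).1 hs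
  -- A periodic swap of adjacent integers inverts only the pairs it swaps, so inverting p < q would
  -- force s = t.
  have hlt : toPerm n s p < toPerm n s q := by
    by_contra hge
    apply hst
    refine toPerm_injective (DFunLike.coe_injective ?_)
    rw [hr, ht]
    rw [hr] at hge
    rcases periodicSwap_cases (not_dvd_succ hn r) p with
      ⟨a, h3, h4⟩ | ⟨a, h3, h4⟩ | ⟨h7, h8, h4⟩ <;>
    rcases periodicSwap_cases (not_dvd_succ hn r) q with
      ⟨b, h5, h6⟩ | ⟨b, h5, h6⟩ | ⟨h7', h8', h6⟩ <;> rw [h4, h6] at hge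
    · omega
    · have h7 : ((n : ℤ) + 1) * b ≠ ((n : ℤ) + 1) * a + 1 := fun h8 =>
        not_dvd_succ hn r ⟨b - a, by linarith⟩
      rw [h3, h5, show r + 1 + ((n : ℤ) + 1) * b = r + 1 + ((n : ℤ) + 1) * a by omega,
        periodicSwap_shift]
    · obtain rfl : q = r + 1 + ((n : ℤ) + 1) * a := by omega
      exact absurd ⟨a, by ring⟩ h8'
    · omega
    · omega
    · omega
    · omega
    · obtain rfl : p = r + ((n : ℤ) + 1) * b := by omega
      exact absurd ⟨b, by ring⟩ h7
    · omega
  refine (step_iff hn _ _).2 ⟨s * t * s⁻¹, _, _, hlt, not_dvd_toPerm hd s, toPerm_conj hd ht s,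
    ?_, ?_⟩
  · rw [hsi]
    calc u * t * s = u * 1 * t * s := by rw [mul_one]
      _ = _ := by rw [← hss]; group
  · have h1 (x : ℤ) : toPerm n (u * s) (toPerm n s x) = toPerm n u x := by
      rw [← Equiv.Perm.mul_apply, ← map_mul, mul_assoc, hss, mul_one]
    rwa [h1, h1]

/-- The lifting property of the Bruhat order. -/
lemma le_mul_simpleReflection (hn : 1 ≤ n) {u w s : W n} (hs : s ∈ simpleReflections n)
    (h : Bruhat.LE (simpleReflections n) u w) :
    Bruhat.LE (simpleReflections n) (u * s) w ∨
      Bruhat.LE (simpleReflections n) (u * s) (w * s) := by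
  induction h with
  | refl => exact Or.inr Relation.ReflTransGen.refl
  | tail hab hbc ih =>
    rcases ih with ih | ih
    · exact Or.inl (ih.tail hbc)
    · rcases step_mul_simpleReflection hn hs hbc with h1 | h1
      · rw [h1] at ih
        exact Or.inl ih
      · exact Or.inr (ih.tail h1)

/-! The window of an element and the vertices of its alcove. -/

/-- The values of the inverse of the affine permutation of `u` at `0, …, n`. -/
noncomputable def window (u : W n) (j : Fin (n + 1)) : ℤ := (toPerm n u)⁻¹ ((j : ℕ) : ℤ)

lemma inv_apply_fin_add_mul (u : W n) (j : Fin (n + 1)) (t : ℤ) :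
    (toPerm n u)⁻¹ (((j : ℕ) : ℤ) + ((n : ℤ) + 1) * t) = window u j + ((n : ℤ) + 1) * t :=
  (isPeriodicPerm_toPerm u).inv.apply_add_mul _ _

lemma window_injective (u : W n) : Function.Injective (window u) := by
  intro i j h
  have := (toPerm n u)⁻¹.injective h
  ext
  exact_mod_cast this

lemma eq_of_window_eq {u w : W n} (h : window u = window w) : u = w := by
  apply inv_injective
  refine toPerm_ext fun m => ?_
  obtain ⟨j, t, rfl⟩ := exists_fin_add_mul n m
  rw [map_inv, map_inv, inv_apply_fin_add_mul, inv_apply_fin_add_mul, h]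

lemma window_mul_of_periodicSwap {p q : ℤ} (h : ¬ ((n : ℤ) + 1) ∣ q - p)
    {t : W n} (ht : ⇑(toPerm n t) = periodicSwap ((n : ℤ) + 1) p q) (u : W n)
    (j : Fin (n + 1)) :
    window (u * t) j = periodicSwap ((n : ℤ) + 1) p q (window u j) := by
  have h1 : t⁻¹ = t := inv_eq_of_mul_eq_one_left (mul_self_of_periodicSwap h ht)
  rw [window, ← map_inv, mul_inv_rev, h1, map_mul, Equiv.Perm.mul_apply, ht, map_inv]
  rfl

lemma ediv_pred {N x : ℤ} (hN : 0 < N) (h : ¬ N ∣ x) : (x - 1) / N = x / N := by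
  have h1 := Int.emod_nonneg x hN.ne'
  have h2 := Int.emod_lt_of_pos x hN
  have h3 := Int.emod_add_mul_ediv x N
  have h4 : x % N ≠ 0 := fun h5 => h (Int.dvd_of_emod_eq_zero h5)
  rw [show x - 1 = (x % N - 1) + N * (x / N) by linarith, Int.add_mul_ediv_left _ _ hN.ne',
    Int.ediv_eq_zero_of_lt (by omega) (by omega), zero_add]

/-- The extended coordinate of -ϖ_i at m is ⌊(m - i)/N⌋ + i/N; evaluate it at m = u⁻¹(j). -/
lemma vertex_coord (u : W n) (i j : Fin (n + 1)) :
    (vertex u i).1 j =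
      (((window u j - ((i : ℕ) : ℤ)) / ((n : ℤ) + 1) : ℤ) : ℝ) + ((i : ℕ) : ℝ) / ((n : ℝ) + 1) := by
  rw [vertex, apply_coord]
  change lift _ (window u j) = _
  obtain ⟨l, t, ht⟩ := exists_fin_add_mul n (window u j)
  have hl := l.isLt
  have hi := i.isLt
  rw [ht, lift_fin_add_mul]
  have h1 : (-fundamentalWeight n i).1 l =
      -((if l < i then (1 : ℝ) else 0) - ((i : ℕ) : ℝ) / ((n : ℝ) + 1)) := rfl
  rw [h1]
  by_cases hli : l < i
  · have hli' : (l : ℕ) < (i : ℕ) := hli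
    rw [show ((l : ℕ) : ℤ) + ((n : ℤ) + 1) * t - ((i : ℕ) : ℤ) =
      (((l : ℕ) : ℤ) - ((i : ℕ) : ℤ) + (n + 1)) + ((n : ℤ) + 1) * (t - 1) by ring,
      Int.add_mul_ediv_left _ _ (by positivity),
      Int.ediv_eq_zero_of_lt (by omega) (by omega)]
    simp [hli]
    ring
  · have hli' : ¬ (l : ℕ) < (i : ℕ) := hli
    rw [show ((l : ℕ) : ℤ) + ((n : ℤ) + 1) * t - ((i : ℕ) : ℤ) =
      (((l : ℕ) : ℤ) - ((i : ℕ) : ℤ)) + ((n : ℤ) + 1) * t by ring,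
      Int.add_mul_ediv_left _ _ (by positivity),
      Int.ediv_eq_zero_of_lt (by omega) (by omega)]
    simp [hli]
    ring

/-- For m = i this says that the coordinates of the i-th vertex sum to zero; periodicity gives all
other m. It normalizes the counting functions near -∞. -/
lemma sum_window_ediv (u : W n) (m : ℤ) :
    ∑ j, (window u j - m) / ((n : ℤ) + 1) = -m := by
  obtain ⟨i, t, rfl⟩ := exists_fin_add_mul n m
  have hN : ((n : ℝ) + 1) ≠ 0 := by positivity
  have h1 : ∑ j, (vertex u i).1 j = 0 := (vertex u i).2
  simp only [vertex_coord, Finset.sum_add_distrib, Finset.sum_const, Finset.card_univ,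
    Fintype.card_fin, nsmul_eq_mul] at h1
  have h2 : ∑ j, (window u j - ((i : ℕ) : ℤ)) / ((n : ℤ) + 1) = -((i : ℕ) : ℤ) := by
    have h3 : ((n + 1 : ℕ) : ℝ) * (((i : ℕ) : ℝ) / ((n : ℝ) + 1)) = (i : ℕ) := by
      push_cast
      field_simp
    rw [h3] at h1
    have h4 : ((∑ j, (window u j - ((i : ℕ) : ℤ)) / ((n : ℤ) + 1) : ℤ) : ℝ) =
        ((-((i : ℕ) : ℤ) : ℤ) : ℝ) := by
      push_cast
      linarith
    exact_mod_cast h4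
  have h3 (j : Fin (n + 1)) : (window u j - (((i : ℕ) : ℤ) + ((n : ℤ) + 1) * t)) / ((n : ℤ) + 1) =
      (window u j - ((i : ℕ) : ℤ)) / ((n : ℤ) + 1) - t := by
    rw [show window u j - (((i : ℕ) : ℤ) + ((n : ℤ) + 1) * t) =
      (window u j - ((i : ℕ) : ℤ)) + ((n : ℤ) + 1) * (-t) by ring,
      Int.add_mul_ediv_left _ _ (by positivity)]
    ring
  simp only [h3, Finset.sum_sub_distrib, h2]
  simp
  ring

/-! The counting function. -/

/-- The number of integers `m' ≥ m` that are mapped to a negative integer by `u`. -/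
noncomputable def negCount (u : W n) (m : ℤ) : ℤ :=
  ∑ j, max 0 ((window u j - m) / ((n : ℤ) + 1))

/-- Only the window entry congruent to m has a floor that changes between m and m + 1. That entry is
m - Nt, and t < 0 exactly when u(m) < 0. -/
lemma negCount_eq_succ (u : W n) (m : ℤ) :
    negCount u m = negCount u (m + 1) + if toPerm n u m < 0 then 1 else 0 := by
  obtain ⟨j, t, ht⟩ := exists_fin_add_mul n (toPerm n u m)
  have hN : (0 : ℤ) < (n : ℤ) + 1 := by positivity
  have hj : window u j = m + ((n : ℤ) + 1) * (-t) := by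
    have h1 := inv_apply_fin_add_mul u j t
    rw [← ht] at h1
    simp at h1
    rw [h1]
    ring
  have hneg : toPerm n u m < 0 ↔ t < 0 := by
    rw [ht]
    have hj := j.isLt
    constructor
    · intro h
      by_contra h1
      have := mul_nonneg hN.le (not_lt.1 h1)
      omega
    · intro h
      have : ((n : ℤ) + 1) * t ≤ ((n : ℤ) + 1) * (-1) :=
        mul_le_mul_of_nonneg_left (by omega) hN.le
      omega
  have key (l : Fin (n + 1)) : max 0 ((window u l - m) / ((n : ℤ) + 1)) =
      max 0 ((window u l - (m + 1)) / ((n : ℤ) + 1)) +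
        if l = j then (if toPerm n u m < 0 then 1 else 0) else 0 := by
    by_cases hl : l = j
    · subst hl
      have h1 : (window u l - m) / ((n : ℤ) + 1) = -t := by
        rw [hj, add_sub_cancel_left, Int.mul_ediv_cancel_left _ hN.ne']
      have h2 : (window u l - (m + 1)) / ((n : ℤ) + 1) = -t - 1 := by
        rw [hj, show m + ((n : ℤ) + 1) * (-t) - (m + 1) = n + ((n : ℤ) + 1) * (-t - 1) by ring,
          Int.add_mul_ediv_left _ _ hN.ne', Int.ediv_eq_zero_of_lt (by positivity) (by omega)]
        ring
      simp only [if_true, h1, h2, hneg]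
      split_ifs <;> omega
    · rw [← sub_sub, ediv_pred hN, if_neg hl, add_zero]
      intro hd
      apply hl
      obtain ⟨a, ha⟩ := hd
      have h1 : window u l = (toPerm n u)⁻¹ (((j : ℕ) : ℤ) + ((n : ℤ) + 1) * (t + a)) := by
        rw [inv_apply_fin_add_mul, hj]
        linarith
      have h2 := (toPerm n u)⁻¹.injective h1
      have h3 := residue_fin_add_mul j (t + a)
      rw [← h2] at h3
      simpa [h3] using (residue_fin_add_mul l 0).symm
  simp only [negCount, key, Finset.sum_add_distrib, Finset.sum_ite_eq', Finset.mem_univ, if_true]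

/-- The floors jump only from m - 1 to m modulo N, and s moves entries only between r and r + 1
modulo N. -/
lemma negCount_mul_simple (hn : 1 ≤ n) {r : ℤ} {s : W n}
    (hs : ⇑(toPerm n s) = periodicSwap ((n : ℤ) + 1) r (r + 1)) (u : W n) {m : ℤ}
    (hm : ¬ ((n : ℤ) + 1) ∣ m - (r + 1)) : negCount (u * s) m = negCount u m := by
  refine Finset.sum_congr rfl fun j _ => ?_
  have hN : (0 : ℤ) < (n : ℤ) + 1 := by positivity
  have hd (t : ℤ) : ¬ ((n : ℤ) + 1) ∣ r + 1 + ((n : ℤ) + 1) * t - m := by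
    rintro ⟨a, ha⟩
    exact hm ⟨t - a, by linarith⟩
  have h1 (t : ℤ) : (r + ((n : ℤ) + 1) * t - m) / ((n : ℤ) + 1) =
      (r + 1 + ((n : ℤ) + 1) * t - m) / ((n : ℤ) + 1) := by
    rw [← ediv_pred hN (hd t)]
    congr 1
    ring
  rw [window_mul_of_periodicSwap (not_dvd_succ hn r) hs]
  rcases periodicSwap_cases (not_dvd_succ hn r) (window u j) with
    ⟨t, h2, h3⟩ | ⟨t, h2, h3⟩ | ⟨-, -, h3⟩
  · rw [h3, h2, h1]
  · rw [h3, h2, h1]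
  · rw [h3]

/-- Only two window entries change. Their floors A, B become B + d and A - d with d = b - a ≥ 0 and
A ≤ B + d: the sum is the same and the larger one has not decreased, so convexity of max(0, ·)
applies. -/
lemma negCount_le_of_step (hn : 1 ≤ n) {u w : W n}
    (h : Bruhat.Step (simpleReflections n) u w) (m : ℤ) : negCount u m ≤ negCount w m := by
  obtain ⟨t, p, q, hpq, hd, ht, rfl, hu⟩ := (step_iff hn u w).1 h
  have hN : (0 : ℤ) < (n : ℤ) + 1 := by positivity
  obtain ⟨i, a, ha⟩ := exists_fin_add_mul n (toPerm n u p)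
  obtain ⟨j, b, hb⟩ := exists_fin_add_mul n (toPerm n u q)
  have hp : p = window u i + ((n : ℤ) + 1) * a := by
    rw [← inv_apply_fin_add_mul, ← ha]
    simp
  have hq : q = window u j + ((n : ℤ) + 1) * b := by
    rw [← inv_apply_fin_add_mul, ← hb]
    simp
  have hij : i ≠ j := by
    rintro rfl
    exact hd ⟨b - a, by rw [hp, hq]; ring⟩
  have hi : window (u * t) i = window u j + ((n : ℤ) + 1) * (b - a) := by
    rw [window_mul_of_periodicSwap hd ht,
      show window u i = p + ((n : ℤ) + 1) * (-a) by rw [hp]; ring, periodicSwap_left, hq]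
    ring
  have hj : window (u * t) j = window u i + ((n : ℤ) + 1) * (a - b) := by
    rw [window_mul_of_periodicSwap hd ht,
      show window u j = q + ((n : ℤ) + 1) * (-b) by rw [hq]; ring, periodicSwap_right hd, hp]
    ring
  have hl (l : Fin (n + 1)) (h1 : l ≠ i) (h2 : l ≠ j) : window (u * t) l = window u l := by
    have aux (c : ℤ) (k : Fin (n + 1)) (hk : l ≠ k) :
        ¬ ((n : ℤ) + 1) ∣ window u l - (window u k + ((n : ℤ) + 1) * c) := by
      rw [← inv_apply_fin_add_mul, window, (isPeriodicPerm_toPerm u).inv.dvd_sub_iff,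
        ← dvd_neg, neg_sub]
      exact not_dvd_root hk c
    rw [window_mul_of_periodicSwap hd ht, periodicSwap_of_not_dvd]
    · rw [hp]
      exact aux a i h1
    · rw [hq]
      exact aux b j h2
  have hab : a ≤ b := by
    by_contra hlt
    have : ((n : ℤ) + 1) * (b + 1) ≤ ((n : ℤ) + 1) * a :=
      mul_le_mul_of_nonneg_left (by omega) hN.le
    have h1 := i.isLt
    have h2 := j.isLt
    rw [ha, hb] at hu
    linarith [show ((j : ℕ) : ℤ) ≤ n by omega, show (0 : ℤ) ≤ ((i : ℕ) : ℤ) by positivity]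
  have hsplit (f : Fin (n + 1) → ℤ) :
      ∑ l, f l = f i + (f j + ∑ l ∈ (Finset.univ.erase i).erase j, f l) := by
    rw [Finset.add_sum_erase _ _ (by simp [hij.symm]), Finset.add_sum_erase _ _ (by simp)]
  rw [negCount, negCount, hsplit, hsplit, hi, hj]
  have hrest : ∑ l ∈ (Finset.univ.erase i).erase j, max 0 ((window (u * t) l - m) / ((n : ℤ) + 1)) =
      ∑ l ∈ (Finset.univ.erase i).erase j, max 0 ((window u l - m) / ((n : ℤ) + 1)) := by
    refine Finset.sum_congr rfl fun l h1 => ?_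
    simp only [Finset.mem_erase, Finset.mem_univ, and_true] at h1
    rw [hl l h1.2 h1.1]
  have e1 : (window u j + ((n : ℤ) + 1) * (b - a) - m) / ((n : ℤ) + 1) =
      (window u j - m) / ((n : ℤ) + 1) + (b - a) := by
    rw [add_sub_right_comm, Int.add_mul_ediv_left _ _ hN.ne']
  have e2 : (window u i + ((n : ℤ) + 1) * (a - b) - m) / ((n : ℤ) + 1) =
      (window u i - m) / ((n : ℤ) + 1) + (a - b) := by
    rw [add_sub_right_comm, Int.add_mul_ediv_left _ _ hN.ne']
  have e3 : (window u i - m) / ((n : ℤ) + 1) ≤ (window u j - m) / ((n : ℤ) + 1) + (b - a) := by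
    rw [← e1]
    refine Int.ediv_le_ediv hN ?_
    rw [hp, hq] at hpq
    linarith
  rw [hrest, e1, e2]
  omega

lemma negCount_le_of_le (hn : 1 ≤ n) {u w : W n}
    (h : Bruhat.LE (simpleReflections n) u w) (m : ℤ) : negCount u m ≤ negCount w m := by
  induction h with
  | refl => exact le_rfl
  | tail _ hbc ih => exact ih.trans (negCount_le_of_step hn hbc m)

/-! Dominant elements. -/

/-- In the fundamental alcove the coordinates increase and spread over less than 1, so successive
periods do not overlap. Hence dominance of an alcove is a statement about the order of the window.
-/
lemma lift_strictMono {v : E n} (hv : v ∈ fundamentalAlcove n) : StrictMono (lift v) := by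
  intro a b hab
  obtain ⟨i, s, rfl⟩ := exists_fin_add_mul n a
  obtain ⟨j, t, rfl⟩ := exists_fin_add_mul n b
  have hi := i.isLt
  have hj := j.isLt
  have hN : (0 : ℤ) < (n : ℤ) + 1 := by positivity
  have hst : s ≤ t := by
    by_contra h
    have : ((n : ℤ) + 1) * (t + 1) ≤ ((n : ℤ) + 1) * s :=
      mul_le_mul_of_nonneg_left (by omega) hN.le
    linarith [show ((j : ℕ) : ℤ) ≤ n by omega, show (0 : ℤ) ≤ ((i : ℕ) : ℤ) by positivity]
  rw [lift_fin_add_mul, lift_fin_add_mul]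
  have hst' : s < t → (s : ℝ) + 1 ≤ t := fun h => by exact_mod_cast h
  rcases lt_trichotomy i j with h | h | h
  · have h1 := hv _ ⟨i, j, h, rfl⟩
    rw [inner_root] at h1
    have : (s : ℝ) ≤ t := by exact_mod_cast hst
    linarith
  · subst h
    have : s < t := by
      by_contra h1
      obtain rfl : s = t := by omega
      exact lt_irrefl _ hab
    linarith [hst' this]
  · have h1 := hv _ ⟨j, i, h, rfl⟩
    rw [inner_root] at h1
    have : s < t := by
      by_contra h1
      obtain rfl : s = t := by omega
      have : (j : ℕ) < (i : ℕ) := h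
      omega
    linarith [hst' this]

lemma alcovePoint_sub (i j : Fin (n + 1)) :
    (alcovePoint n).1 i - (alcovePoint n).1 j =
      (((i : ℕ) : ℝ) - ((j : ℕ) : ℝ)) / ((n : ℝ) + 1) := by
  simp only [alcovePoint]
  ring

lemma alcovePoint_mem : alcovePoint n ∈ fundamentalAlcove n := by
  rintro _ ⟨i, j, h, rfl⟩
  have hN : (0 : ℝ) < (n : ℝ) + 1 := by positivity
  rw [inner_root, alcovePoint_sub]
  have h1 : ((i : ℕ) : ℝ) < ((j : ℕ) : ℝ) := by exact_mod_cast h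
  have h2 : ((j : ℕ) : ℝ) < (n : ℝ) + 1 := by exact_mod_cast j.isLt
  have h3 : (0 : ℝ) ≤ ((i : ℕ) : ℝ) := by positivity
  constructor
  · rw [lt_div_iff₀ hN]
    linarith
  · exact div_neg_of_neg_of_pos (by linarith) hN

lemma mem_dominantElements_iff (u : W n) : u ∈ dominantElements n ↔ StrictAnti (window u) := by
  constructor
  · intro h i j hij
    have h1 := h ⟨_, alcovePoint_mem, rfl⟩ _ ⟨i, j, hij, rfl⟩
    rw [inner_root, apply_coord, apply_coord, sub_pos] at h1
    exact (lift_strictMono alcovePoint_mem).lt_iff_lt.1 h1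
  · rintro h _ ⟨v, hv, rfl⟩ _ ⟨i, j, hij, rfl⟩
    rw [inner_root, apply_coord, apply_coord, sub_pos]
    exact lift_strictMono hv (h hij)

lemma closure_dominantChamber :
    closure (dominantChamber n) = {v | ∀ α ∈ positiveRoots n, (0 : ℝ) ≤ inner ℝ α v} := by
  apply subset_antisymm
  · refine closure_minimal (fun v hv α hα => (hv α hα).le) ?_
    simp only [Set.ofPred_forall]
    exact isClosed_biInter fun α _ => isClosed_le continuous_const (by fun_prop)
  · intro v hv
    -- Moving v slightly in the direction of the strictly dominant point `-alcovePoint n` makes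
    -- every inequality strict.
    have hlim : Filter.Tendsto (fun k : ℕ => v + (1 / ((k : ℝ) + 1)) • (-alcovePoint n))
        Filter.atTop (nhds v) := by
      simpa using ((tendsto_one_div_add_atTop_nhds_zero_nat (𝕜 := ℝ)).smul_const (-alcovePoint n)).const_add v
    refine mem_closure_of_tendsto hlim (Filter.Eventually.of_forall fun k α hα => ?_)
    have h0 := real_inner_smul_right α (-alcovePoint n) (1 / ((k : ℝ) + 1))
    rw [inner_neg_right] at h0
    refine lt_of_lt_of_eq ?_ ((inner_add_right _ _ _).trans (congrArg _ h0)).symm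
    have h1 := hv α hα
    have h2 := (alcovePoint_mem α hα).2
    have h3 : (0 : ℝ) < 1 / ((k : ℝ) + 1) := by positivity
    nlinarith

lemma vertex_mem_closure_iff (u : W n) (i : Fin (n + 1)) :
    vertex u i ∈ closure (dominantChamber n) ↔
      Antitone fun j => (window u j - ((i : ℕ) : ℤ)) / ((n : ℤ) + 1) := by
  rw [closure_dominantChamber]
  have key (a b : Fin (n + 1)) : (0 : ℝ) ≤ inner ℝ (root n a b) (vertex u i) ↔
      (window u b - ((i : ℕ) : ℤ)) / ((n : ℤ) + 1) ≤
        (window u a - ((i : ℕ) : ℤ)) / ((n : ℤ) + 1) := by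
    rw [inner_root, vertex_coord, vertex_coord, add_sub_add_right_eq_sub, sub_nonneg, Int.cast_le]
  constructor
  · intro h a b hab
    rcases hab.eq_or_lt with rfl | hab
    · exact le_rfl
    · exact (key a b).1 (h _ ⟨a, b, hab, rfl⟩)
  · rintro h _ ⟨a, b, hab, rfl⟩
    exact (key a b).2 (h hab.le)

lemma antitone_window_ediv {u : W n} (h : u ∈ dominantElements n) (m : ℤ) :
    Antitone fun j => (window u j - m) / ((n : ℤ) + 1) := fun a b hab =>
  Int.ediv_le_ediv (by positivity)
    (sub_le_sub_right (((mem_dominantElements_iff u).1 h).antitone hab) _)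

/-- Choosing i as the residue of `window u b` makes the floor at b exact, so the comparison of
floors becomes one of the entries themselves; injectivity makes it strict. -/
lemma mem_dominantElements_of_vertex {u : W n}
    (h : ∀ i, vertex u i ∈ closure (dominantChamber n)) : u ∈ dominantElements n := by
  rw [mem_dominantElements_iff]
  intro a b hab
  refine lt_of_le_of_ne ?_ fun h1 => hab.ne (window_injective u h1).symm
  obtain ⟨i, t, ht⟩ := exists_fin_add_mul n (window u b)
  have hN : (0 : ℤ) < (n : ℤ) + 1 := by positivity
  have h1 := (vertex_mem_closure_iff u i).1 (h i) hab.le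
  simp only at h1
  rw [ht, add_sub_cancel_left, Int.mul_ediv_cancel_left _ hN.ne', Int.le_ediv_iff_mul_le hN] at h1
  rw [ht]
  linarith

/-! The cone generated by the simple roots. -/

/-- The sum of the first `k` coordinates. -/
def partialSum (n k : ℕ) : E n →ₗ[ℝ] ℝ where
  toFun v := ∑ l : Fin (n + 1), if (l : ℕ) < k then v.1 l else 0
  map_add' v w := by
    rw [← Finset.sum_add_distrib]
    refine Finset.sum_congr rfl fun l _ => ?_
    split_ifs <;> simp
  map_smul' c v := by
    simp [Finset.mul_sum]

lemma partialSum_apply (k : ℕ) (v : E n) :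
    partialSum n k v = ∑ l : Fin (n + 1), if (l : ℕ) < k then v.1 l else 0 := rfl

lemma partialSum_succ (l : Fin (n + 1)) (v : E n) :
    partialSum n ((l : ℕ) + 1) v = partialSum n (l : ℕ) v + v.1 l := by
  rw [partialSum_apply, partialSum_apply]
  rw [show v.1 l = ∑ x, if x = l then v.1 x else 0 by simp, ← Finset.sum_add_distrib]
  refine Finset.sum_congr rfl fun x _ => ?_
  rcases lt_trichotomy x l with h | h | h
  · have h' : (x : ℕ) < (l : ℕ) := h
    simp [h', h.ne, Nat.lt_succ_of_lt h']
  · simp [h]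
  · have h' : (l : ℕ) < (x : ℕ) := h
    simp [h.ne', show ¬ (x : ℕ) < (l : ℕ) + 1 by omega, show ¬ (x : ℕ) < (l : ℕ) by omega]

lemma partialSum_of_lt {k : ℕ} (hk : n < k) (v : E n) : partialSum n k v = 0 := by
  have h : ∑ l, v.1 l = 0 := v.2
  rw [partialSum_apply, ← h]
  refine Finset.sum_congr rfl fun l _ => ?_
  rw [if_pos (by have := l.isLt; omega)]

lemma partialSum_simpleRoot (k : ℕ) (i : Fin n) :
    partialSum n k (simpleRoot n i) = if k = (i : ℕ) + 1 then 1 else 0 := by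
  have h (l : Fin (n + 1)) : (simpleRoot n i).1 l =
      (if l = i.castSucc then 1 else 0) - if l = i.succ then 1 else 0 := by
    simp [simpleRoot, root, PiLp.single_apply]
  have h2 : partialSum n k (simpleRoot n i) =
      (if (i : ℕ) < k then 1 else 0) - if (i : ℕ) + 1 < k then 1 else 0 := by
    have e1 : ∑ l : Fin (n + 1), (if l = i.castSucc then (if (l : ℕ) < k then (1 : ℝ) else 0) else 0)
        = if (i : ℕ) < k then 1 else 0 := by
      rw [Finset.sum_ite_eq' Finset.univ i.castSucc fun l => if (l : ℕ) < k then (1 : ℝ) else 0]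
      simp
    have e2 : ∑ l : Fin (n + 1), (if l = i.succ then (if (l : ℕ) < k then (1 : ℝ) else 0) else 0)
        = if (i : ℕ) + 1 < k then 1 else 0 := by
      rw [Finset.sum_ite_eq' Finset.univ i.succ fun l => if (l : ℕ) < k then (1 : ℝ) else 0]
      simp
    rw [partialSum_apply, ← e1, ← e2, ← Finset.sum_sub_distrib]
    refine Finset.sum_congr rfl fun l _ => ?_
    rw [h]
    split_ifs <;> simp
  rw [h2]
  split_ifs <;> first | omega | norm_num

/-- The coefficient of α_k in v is the sum of the first k coordinates of v. -/
lemma mem_simpleCone_iff (v : E n) : v ∈ simpleCone n ↔ ∀ k, 0 ≤ partialSum n k v := by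
  constructor
  · rintro ⟨c, hc, rfl⟩ k
    rw [map_sum]
    refine Finset.sum_nonneg fun i _ => ?_
    rw [map_smul, partialSum_simpleRoot, smul_eq_mul]
    exact mul_nonneg (hc i) (by split_ifs <;> norm_num)
  · intro h
    refine ⟨fun i => partialSum n ((i : ℕ) + 1) v, fun i => h _, ?_⟩
    have key (k : ℕ) : partialSum n k v =
        partialSum n k (∑ i : Fin n, partialSum n ((i : ℕ) + 1) v • simpleRoot n i) := by
      rw [map_sum]
      simp only [map_smul, partialSum_simpleRoot, smul_eq_mul]
      by_cases hk0 : k = 0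
      · subst hk0
        simp [partialSum_apply]
      by_cases hk : n < k
      · rw [partialSum_of_lt hk, Finset.sum_eq_zero]
        intro i _
        rw [if_neg (by have := i.isLt; omega), mul_zero]
      · rw [Finset.sum_eq_single (⟨k - 1, by omega⟩ : Fin n)]
        · simp [Nat.sub_add_cancel (show 1 ≤ k by omega)]
        · intro i _ hi
          rw [if_neg, mul_zero]
          intro hk
          apply hi
          ext
          simp
          omega
        · simp
    ext l
    have h1 := partialSum_succ l v
    have h2 := partialSum_succ l (∑ i : Fin n, partialSum n ((i : ℕ) + 1) v • simpleRoot n i)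
    rw [← key, ← key] at h2
    linarith

/-! Dominance of integer vectors. -/

lemma exists_lt_iff_of_antitone {N : ℕ} {p : Fin N → ℤ} (hp : Antitone p) (c : ℤ) :
    ∃ k : ℕ, ∀ l : Fin N, (l : ℕ) < k ↔ c < p l := by
  classical
  have hex : ∃ k : ℕ, ∀ h : k < N, p ⟨k, h⟩ ≤ c := ⟨N, fun h => absurd h (lt_irrefl _)⟩
  refine ⟨Nat.find hex, fun l => ⟨fun h => ?_, fun h => ?_⟩⟩
  · have h1 := Nat.find_min hex h
    push Not at h1
    exact h1.2
  · by_contra h1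
    push Not at h1
    have h2 := Nat.find_spec hex (h1.trans_lt l.isLt)
    have h3 : p l ≤ p ⟨Nat.find hex, h1.trans_lt l.isLt⟩ := hp h1
    omega

/-- As p decreases, its terms exceeding c form an initial segment. Compare partial sums there;
passing to positive parts only enlarges the side of q. -/
lemma sum_max_le_of_partialSums {N : ℕ} {p q : Fin N → ℤ} (hp : Antitone p)
    (h : ∀ k : ℕ, (∑ l : Fin N, if (l : ℕ) < k then p l else 0) ≤ ∑ l : Fin N, if (l : ℕ) < k then q l else 0)
    (c : ℤ) : ∑ l, max 0 (p l - c) ≤ ∑ l, max 0 (q l - c) := by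
  obtain ⟨k, hk⟩ := exists_lt_iff_of_antitone hp c
  have h1 (f : Fin N → ℤ) : (∑ l : Fin N, if (l : ℕ) < k then f l - c else 0) =
      (∑ l : Fin N, if (l : ℕ) < k then f l else 0) - ∑ l : Fin N, if (l : ℕ) < k then c else 0 := by
    rw [← Finset.sum_sub_distrib]
    refine Finset.sum_congr rfl fun l _ => ?_
    split_ifs <;> simp
  calc ∑ l, max 0 (p l - c) = ∑ l : Fin N, if (l : ℕ) < k then p l - c else 0 := by
        refine Finset.sum_congr rfl fun l _ => ?_
        have := hk l
        split_ifs <;> omega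
    _ ≤ ∑ l : Fin N, if (l : ℕ) < k then q l - c else 0 := by
        rw [h1, h1]
        exact sub_le_sub_right (h k) _
    _ ≤ _ := by
        refine Finset.sum_le_sum fun l _ => ?_
        split_ifs <;> omega

/-- With c the k-th entry of the decreasing q, the sum of positive parts of q - c equals its k-th
partial sum, while for p it is an upper bound. -/
lemma partialSums_le_of_sum_max {N : ℕ} {p q : Fin (N + 1) → ℤ} (hq : Antitone q)
    (h : ∀ c : ℤ, ∑ l, max 0 (p l - c) ≤ ∑ l, max 0 (q l - c)) (k : ℕ) :
    (∑ l : Fin (N + 1), if (l : ℕ) < k then p l else 0) ≤ ∑ l : Fin (N + 1), if (l : ℕ) < k then q l else 0 := by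
  rcases Nat.eq_zero_or_pos k with rfl | hk
  · simp
  -- The minimum covers k > N + 1, where the partial sum is the full sum and c the last entry.
  set c := q ⟨min (k - 1) N, by omega⟩ with hc
  have h1 (f : Fin (N + 1) → ℤ) : (∑ l : Fin (N + 1), if (l : ℕ) < k then f l - c else 0) =
      (∑ l : Fin (N + 1), if (l : ℕ) < k then f l else 0) -
        ∑ l : Fin (N + 1), if (l : ℕ) < k then c else 0 := by
    rw [← Finset.sum_sub_distrib]
    refine Finset.sum_congr rfl fun l _ => ?_
    split_ifs <;> simp
  have h2 : ∑ l, max 0 (q l - c) = ∑ l : Fin (N + 1), if (l : ℕ) < k then q l - c else 0 := by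
    refine Finset.sum_congr rfl fun l _ => ?_
    have hl := l.isLt
    split_ifs with h3
    · have : c ≤ q l := hq (Fin.mk_le_mk.2 (by omega) : l ≤ ⟨min (k - 1) N, by omega⟩)
      omega
    · have : q l ≤ c := hq (Fin.mk_le_mk.2 (by omega) : (⟨min (k - 1) N, by omega⟩ : Fin _) ≤ l)
      omega
  have h3 : (∑ l : Fin (N + 1), if (l : ℕ) < k then p l - c else 0) ≤ ∑ l, max 0 (p l - c) := by
    refine Finset.sum_le_sum fun l _ => ?_
    split_ifs <;> omega
  have h4 := h c
  rw [h2, h1] at h4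
  rw [h1] at h3
  linarith

/-! ### Cone conditions on vertices and counting functions -/

lemma negCount_fin_add_mul (u : W n) (i : Fin (n + 1)) (c : ℤ) :
    negCount u (((i : ℕ) : ℤ) + ((n : ℤ) + 1) * c) =
      ∑ j, max 0 ((window u j - ((i : ℕ) : ℤ)) / ((n : ℤ) + 1) - c) := by
  refine Finset.sum_congr rfl fun j _ => ?_
  rw [show window u j - (((i : ℕ) : ℤ) + ((n : ℤ) + 1) * c) =
    (window u j - ((i : ℕ) : ℤ)) + ((n : ℤ) + 1) * (-c) by ring,
    Int.add_mul_ediv_left _ _ (by positivity)]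
  rfl

lemma partialSum_vertex_sub (x y : W n) (i : Fin (n + 1)) (k : ℕ) :
    0 ≤ partialSum n k (vertex y i - vertex x i) ↔
      (∑ l : Fin (n + 1), if (l : ℕ) < k then
        (window x l - ((i : ℕ) : ℤ)) / ((n : ℤ) + 1) else 0) ≤
      ∑ l : Fin (n + 1), if (l : ℕ) < k then
        (window y l - ((i : ℕ) : ℤ)) / ((n : ℤ) + 1) else 0 := by
  have h : partialSum n k (vertex y i - vertex x i) =
      (((∑ l : Fin (n + 1), if (l : ℕ) < k then
        (window y l - ((i : ℕ) : ℤ)) / ((n : ℤ) + 1) else 0) -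
      ∑ l : Fin (n + 1), if (l : ℕ) < k then
        (window x l - ((i : ℕ) : ℤ)) / ((n : ℤ) + 1) else 0 : ℤ) : ℝ) := by
    rw [← Finset.sum_sub_distrib, partialSum_apply, Int.cast_sum]
    refine Finset.sum_congr rfl fun l _ => ?_
    split_ifs
    · have h1 : (vertex y i - vertex x i).1 l = (vertex y i).1 l - (vertex x i).1 l := rfl
      rw [h1, vertex_coord, vertex_coord]
      push_cast
      ring
    · simp
  rw [h, Int.cast_nonneg_iff, sub_nonneg]

/-- For dominant elements, the dominance order of the vertices is the order of the counting
functions. -/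
lemma vertex_sub_mem_iff {x y : W n} (hx : x ∈ dominantElements n) (hy : y ∈ dominantElements n) :
    (∀ i, vertex y i - vertex x i ∈ simpleCone n) ↔ ∀ m, negCount x m ≤ negCount y m := by
  simp only [mem_simpleCone_iff, partialSum_vertex_sub]
  constructor
  · intro h m
    obtain ⟨i, c, rfl⟩ := exists_fin_add_mul n m
    rw [negCount_fin_add_mul, negCount_fin_add_mul]
    exact sum_max_le_of_partialSums (antitone_window_ediv hx _) (h i) c
  · intro h i
    refine partialSums_le_of_sum_max (antitone_window_ediv hy _) fun c => ?_
    rw [← negCount_fin_add_mul, ← negCount_fin_add_mul]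
    exact h _

/-! The Bruhat order on dominant elements. -/

lemma toPerm_apply_eq_iff (u : W n) (m : ℤ) (j : Fin (n + 1)) (t : ℤ) :
    toPerm n u m = ((j : ℕ) : ℤ) + ((n : ℤ) + 1) * t ↔ m = window u j + ((n : ℤ) + 1) * t := by
  rw [← inv_apply_fin_add_mul, Equiv.Perm.eq_inv_iff_eq]

/-- The set of window entries is thus determined by the signs of the values of u, and a decreasing
window is determined by its set of entries. -/
lemma exists_window_eq_iff (u : W n) (m : ℤ) :
    (∃ j, window u j = m) ↔ 0 ≤ toPerm n u m ∧ toPerm n u (m - ((n : ℤ) + 1)) < 0 := by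
  have h1 : toPerm n u (m - ((n : ℤ) + 1)) = toPerm n u m - ((n : ℤ) + 1) := by
    have := isPeriodicPerm_toPerm u (m - ((n : ℤ) + 1))
    rw [sub_add_cancel] at this
    omega
  rw [h1]
  constructor
  · rintro ⟨j, hj⟩
    have h2 := (toPerm_apply_eq_iff u m j 0).2 (by simp [hj])
    have h3 := j.isLt
    omega
  · rintro ⟨h2, h3⟩
    refine ⟨⟨(toPerm n u m).toNat, by omega⟩, ?_⟩
    have h4 := (toPerm_apply_eq_iff u m ⟨(toPerm n u m).toNat, by omega⟩ 0).1 (by simp [h2])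
    simpa using h4.symm

/-- A dominant element is determined by its counting function. -/
lemma eq_of_negCount_eq {x y : W n} (hx : x ∈ dominantElements n) (hy : y ∈ dominantElements n)
    (h : ∀ m, negCount x m = negCount y m) : x = y := by
  have hneg (m : ℤ) : toPerm n x m < 0 ↔ toPerm n y m < 0 := by
    have h1 := negCount_eq_succ x m
    have h2 := negCount_eq_succ y m
    rw [h, h (m + 1)] at h1
    split_ifs at h1 h2 <;> omega
  apply eq_of_window_eq
  rw [← ((mem_dominantElements_iff x).1 hx).range_inj ((mem_dominantElements_iff y).1 hy)]
  ext m
  simp only [Set.mem_range, exists_window_eq_iff, ← not_lt, hneg]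

/-- Far to the left all floors are nonnegative, the maxima disappear, and `sum_window_ediv` applies;
so all counting functions agree there. -/
lemma negCount_eq_neg (u : W n) : ∃ M, ∀ m ≤ M, negCount u m = -m := by
  obtain ⟨M, hM⟩ := (Set.finite_range (window u)).bddBelow
  refine ⟨M, fun m hm => ?_⟩
  rw [← sum_window_ediv u m]
  refine Finset.sum_congr rfl fun j _ => ?_
  rw [max_eq_right]
  exact Int.ediv_nonneg (by linarith [hM ⟨j, rfl⟩]) (by positivity)

lemma negCount_eq_zero (u : W n) : ∃ M, ∀ m ≥ M, negCount u m = 0 := by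
  obtain ⟨M, hM⟩ := (Set.finite_range (window u)).bddAbove
  refine ⟨M, fun m hm => Finset.sum_eq_zero fun j _ => ?_⟩
  rw [max_eq_left]
  exact Int.ediv_nonpos_of_nonpos_of_neg (by linarith [hM ⟨j, rfl⟩]) (by positivity)

lemma negCount_nonneg (u : W n) (m : ℤ) : 0 ≤ negCount u m :=
  Finset.sum_nonneg fun _ _ => le_max_left _ _

/-- If the integers mapped to negative integers by `y` form an initial segment, then the counting
function of `y` is minimal. -/
lemma negCount_le_of_no_descent {y : W n}
    (hy : ∀ m, toPerm n y (m + 1) < 0 → toPerm n y m < 0) (x : W n) (m : ℤ) :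
    negCount y m ≤ negCount x m := by
  by_cases hm : toPerm n y m < 0
  · have hdown (k : ℕ) : toPerm n y (m - k) < 0 := by
      induction k with
      | zero => simpa using hm
      | succ k ih =>
        apply hy
        push_cast
        rwa [sub_add_eq_sub_sub, sub_add_cancel]
    -- Walking left from m, the count of y gains one at each step and that of x at most one;
    -- eventually they agree.
    have hgrow (k : ℕ) : negCount y m - negCount x m ≤ negCount y (m - k) - negCount x (m - k) := by
      induction k with
      | zero => simp
      | succ k ih =>
        have h1 := negCount_eq_succ y (m - (k + 1 : ℕ))
        have h2 := negCount_eq_succ x (m - (k + 1 : ℕ))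
        rw [if_pos (hdown (k + 1))] at h1
        rw [show m - ((k + 1 : ℕ) : ℤ) + 1 = m - k by push_cast; ring] at h1 h2
        split_ifs at h2 <;> omega
    obtain ⟨M, hM⟩ := negCount_eq_neg y
    obtain ⟨M', hM'⟩ := negCount_eq_neg x
    have h1 := hgrow (m - min M (min M' m)).toNat
    have h2 := hM (m - (m - min M (min M' m)).toNat) (by omega)
    have h3 := hM' (m - (m - min M (min M' m)).toNat) (by omega)
    omega
  · have hup (k : ℕ) : ¬ toPerm n y (m + k) < 0 := by
      induction k with
      | zero => simpa using hm
      | succ k ih =>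
        intro h
        exact ih (hy _ (by rwa [add_assoc]))
    have hconst (k : ℕ) : negCount y m = negCount y (m + k) := by
      induction k with
      | zero => simp
      | succ k ih =>
        rw [ih, negCount_eq_succ, if_neg (hup k), add_zero, add_assoc]
        rfl
    obtain ⟨M, hM⟩ := negCount_eq_zero y
    rw [hconst (M - m).toNat, hM _ (by omega)]
    exact negCount_nonneg x m

/-! ### Sign descents: u(r) ≥ 0 > u(r + 1) -/

section Descent

variable {r : ℤ} {s u : W n}

lemma toPerm_mul_left (hs : ⇑(toPerm n s) = periodicSwap ((n : ℤ) + 1) r (r + 1)) :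
    toPerm n (u * s) r = toPerm n u (r + 1) := by
  have h := periodicSwap_left ((n : ℤ) + 1) r (r + 1) 0
  simp only [mul_zero, add_zero] at h
  rw [map_mul, Equiv.Perm.mul_apply, hs, h]

lemma toPerm_mul_right (hn : 1 ≤ n)
    (hs : ⇑(toPerm n s) = periodicSwap ((n : ℤ) + 1) r (r + 1)) :
    toPerm n (u * s) (r + 1) = toPerm n u r := by
  have h := periodicSwap_right (not_dvd_succ hn r) 0
  simp only [mul_zero, add_zero] at h
  rw [map_mul, Equiv.Perm.mul_apply, hs, h]

lemma step_of_descent (hn : 1 ≤ n) (hs : ⇑(toPerm n s) = periodicSwap ((n : ℤ) + 1) r (r + 1))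
    (h0 : 0 ≤ toPerm n u r) (h1 : toPerm n u (r + 1) < 0) :
    Bruhat.Step (simpleReflections n) (u * s) u := by
  refine (step_iff hn _ _).2 ⟨s, r, r + 1, by omega, not_dvd_succ hn r, hs, ?_, ?_⟩
  · rw [mul_assoc, mul_self_of_periodicSwap (not_dvd_succ hn r) hs, mul_one]
  · rw [toPerm_mul_left hs, toPerm_mul_right hn hs]
    omega

/-- The order can break only if r + 1 + Na and r + Na are both window entries for the same a. Then
u(r) and u(r + 1) lie in the same period -Na, …, -Na + n and have the same sign, against the sign
descent. -/
lemma mul_mem_dominantElements (hn : 1 ≤ n)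
    (hs : ⇑(toPerm n s) = periodicSwap ((n : ℤ) + 1) r (r + 1))
    (h0 : 0 ≤ toPerm n u r) (h1 : toPerm n u (r + 1) < 0) (hu : u ∈ dominantElements n) :
    u * s ∈ dominantElements n := by
  rw [mem_dominantElements_iff] at hu ⊢
  have hN : (0 : ℤ) < (n : ℤ) + 1 := by positivity
  intro i j hij
  have hlt := hu hij
  have hd := not_dvd_succ hn r
  rw [window_mul_of_periodicSwap hd hs, window_mul_of_periodicSwap hd hs]
  rcases periodicSwap_cases hd (window u i) with ⟨a, h3, h4⟩ | ⟨a, h3, h4⟩ | ⟨h7, h8, h4⟩ <;>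
  rcases periodicSwap_cases hd (window u j) with
    ⟨b, h5, h6⟩ | ⟨b, h5, h6⟩ | ⟨h7', h8', h6⟩ <;> rw [h4, h6]
  · omega
  · omega
  · omega
  · by_contra
    have h9 : ((n : ℤ) + 1) * a ≠ ((n : ℤ) + 1) * b + 1 := fun h9 => hd ⟨a - b, by linarith⟩
    have hab : ((n : ℤ) + 1) * a = ((n : ℤ) + 1) * b := by omega
    have e1 := (toPerm_apply_eq_iff u r j (-b)).2 (by rw [h5]; ring)
    have e2 := (toPerm_apply_eq_iff u (r + 1) i (-a)).2 (by rw [h3]; ring)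
    rw [e1] at h0
    rw [e2] at h1
    have hi := i.isLt
    have hj := j.isLt
    obtain rfl : a = b := by simpa [hN.ne'] using hab
    rcases le_or_gt a 0 with h | h
    · have := mul_nonneg hN.le (neg_nonneg.2 h)
      omega
    · have : ((n : ℤ) + 1) * (-a) ≤ ((n : ℤ) + 1) * (-1) :=
        mul_le_mul_of_nonneg_left (by omega) hN.le
      omega
  · omega
  · have : window u j ≠ r + ((n : ℤ) + 1) * a := fun h => h7' ⟨a, by rw [h]; ring⟩
    omega
  · have : window u i ≠ r + 1 + ((n : ℤ) + 1) * b := fun h => h8 ⟨b, by rw [h]; ring⟩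
    omega
  · omega
  · omega

lemma negCount_mul_succ (hn : 1 ≤ n)
    (hs : ⇑(toPerm n s) = periodicSwap ((n : ℤ) + 1) r (r + 1)) :
    negCount (u * s) (r + 1) = negCount u (r + 2) + if toPerm n u r < 0 then 1 else 0 := by
  rw [negCount_eq_succ, toPerm_mul_right hn hs, add_assoc, one_add_one_eq_two,
    negCount_mul_simple hn hs]
  rw [show r + 2 - (r + 1) = r + 1 - r by ring]
  exact not_dvd_succ hn r

end Descent

/-- On dominant elements, the order of the counting functions implies the Bruhat order. -/
lemma le_of_negCount_le (hn : 1 ≤ n) {x y : W n}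
    (hx : x ∈ dominantElements n) (hy : y ∈ dominantElements n)
    (h : ∀ m, negCount x m ≤ negCount y m) : Bruhat.LE (simpleReflections n) x y := by
  induction hk : Bruhat.length (simpleReflections n) y using Nat.strong_induction_on
    generalizing x y with
  | _ k ih =>
  subst hk
  by_cases hdesc : ∃ r, 0 ≤ toPerm n y r ∧ toPerm n y (r + 1) < 0
  · obtain ⟨r, h0, h1⟩ := hdesc
    obtain ⟨s, hs⟩ := exists_toPerm_eq_periodicSwap (not_dvd_succ hn r)
    -- The sign descent of x, if there is one, may sit at another translate of r than that of y; the
    -- same s serves all translates.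
    have hs' (t : ℤ) : ⇑(toPerm n s) = periodicSwap ((n : ℤ) + 1) (r + ((n : ℤ) + 1) * t)
        (r + ((n : ℤ) + 1) * t + 1) := by
      rw [add_right_comm, periodicSwap_shift, hs]
    have hsS : s ∈ simpleReflections n := (mem_simpleReflections_iff hn s).2 ⟨r, hs⟩
    have hstep := step_of_descent hn hs h0 h1
    have hys := mul_mem_dominantElements hn hs h0 h1 hy
    obtain ⟨-, -, -, hlen⟩ := id hstep
    have hper (u : W n) (t : ℤ) : toPerm n u (r + ((n : ℤ) + 1) * t) =
        toPerm n u r + ((n : ℤ) + 1) * t ∧ toPerm n u (r + ((n : ℤ) + 1) * t + 1) =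
        toPerm n u (r + 1) + ((n : ℤ) + 1) * t :=
      ⟨(isPeriodicPerm_toPerm u).apply_add_mul _ _, by
        rw [add_right_comm, (isPeriodicPerm_toPerm u).apply_add_mul]⟩
    have hm (m : ℤ) : ¬ ((n : ℤ) + 1) ∣ m - (r + 1) ∨
        ∃ t, m = r + ((n : ℤ) + 1) * t + 1 := by
      by_cases hd : ((n : ℤ) + 1) ∣ m - (r + 1)
      · obtain ⟨t, ht⟩ := hd
        exact Or.inr ⟨t, by linarith⟩
      · exact Or.inl hd
    have expand (u : W n) (t : ℤ) := negCount_eq_succ u (r + ((n : ℤ) + 1) * t)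
    have expand' (u : W n) (t : ℤ) : negCount u (r + ((n : ℤ) + 1) * t + 1) =
        negCount u (r + ((n : ℤ) + 1) * t + 2) +
          if toPerm n u (r + ((n : ℤ) + 1) * t + 1) < 0 then 1 else 0 := by
      rw [negCount_eq_succ, add_assoc (r + ((n : ℤ) + 1) * t), one_add_one_eq_two]
    by_cases hxd : ∃ t, 0 ≤ toPerm n x (r + ((n : ℤ) + 1) * t) ∧
        toPerm n x (r + ((n : ℤ) + 1) * t + 1) < 0
    · obtain ⟨t, hx0, hx1⟩ := hxd
      have hxs := mul_mem_dominantElements hn (hs' t) hx0 hx1 hx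
      have hle : Bruhat.LE (simpleReflections n) (x * s) (y * s) := by
        refine ih _ hlen hxs hys (fun m => ?_) rfl
        rcases hm m with hd | ⟨a, rfl⟩
        · rw [negCount_mul_simple hn hs _ hd, negCount_mul_simple hn hs _ hd]
          exact h m
        · rw [negCount_mul_succ hn (hs' a), negCount_mul_succ hn (hs' a)]
          have e1 := h (r + ((n : ℤ) + 1) * a)
          have e2 := h (r + ((n : ℤ) + 1) * a + 2)
          rw [expand x, expand y, expand' x, expand' y] at e1
          -- By periodicity the descent at t gives x(r + Na) > x(r + Na + 1) at every translate a.
          have e3 := hper x t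
          have e4 := hper x a
          split_ifs at e1 ⊢ <;> omega
      rcases le_mul_simpleReflection hn hsS hle with h2 | h2
      · rw [mul_assoc, simpleReflections_mul_self hn hsS, mul_one] at h2
        exact h2.tail hstep
      · rwa [mul_assoc, simpleReflections_mul_self hn hsS, mul_one, mul_assoc,
          simpleReflections_mul_self hn hsS, mul_one] at h2
    · push Not at hxd
      refine Relation.ReflTransGen.tail (ih _ hlen hx hys (fun m => ?_) rfl) hstep
      rcases hm m with hd | ⟨a, rfl⟩
      · rw [negCount_mul_simple hn hs _ hd]
        exact h m
      · rw [negCount_mul_succ hn (hs' a)]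
        have e1 := h (r + ((n : ℤ) + 1) * a)
        have e2 := h (r + ((n : ℤ) + 1) * a + 2)
        rw [expand x, expand y, expand' x, expand' y] at e1
        rw [expand' x]
        -- Without a sign descent, x(r + Na + 1) < 0 forces x(r + Na) < 0, so the inequalities at
        -- the two neighbours imply the middle one.
        have e3 := hxd a
        split_ifs at e1 ⊢ <;> omega
  · push Not at hdesc
    have hxy : x = y := eq_of_negCount_eq hx hy fun m => (h m).antisymm <|
      negCount_le_of_no_descent (fun m hm => by
        by_contra h0
        exact absurd (hdesc m (not_lt.1 h0)) (not_le.2 hm)) x m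
    rw [hxy]
    exact Relation.ReflTransGen.refl

/-! ### Parallelotopes and the conclusion -/

lemma mem_parallelotope_iff (x y z : W n) (i : Fin (n + 1)) :
    vertex z i ∈ parallelotope x y i ↔
      vertex z i - vertex x i ∈ simpleCone n ∧ vertex y i - vertex z i ∈ simpleCone n := by
  rw [parallelotope, Set.mem_inter_iff, Set.singleton_add, Set.singleton_sub, Set.mem_image,
    Set.mem_image]
  refine and_congr ⟨?_, fun h => ⟨_, h, by simp⟩⟩ ⟨?_, fun h => ⟨_, h, by simp⟩⟩
  · rintro ⟨c, hc, h⟩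
    rw [← h]
    simpa using hc
  · rintro ⟨c, hc, h⟩
    rw [← h]
    simpa using hc

end AffineA

theorem propositionB (n : ℕ) (hn : 1 ≤ n) (x y z : AffineA.W n)
    (hx : x ∈ AffineA.dominantElements n) (hy : y ∈ AffineA.dominantElements n) :
    z ∈ Bruhat.interval (AffineA.simpleReflections n) x y ∩ AffineA.dominantElements n ↔
      ∀ i : Fin (n + 1),
        AffineA.vertex z i ∈
          AffineA.parallelotope x y i ∩ closure (AffineA.dominantChamber n) := by
  simp only [Set.mem_inter_iff, AffineA.mem_parallelotope_iff]
  constructor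
  · rintro ⟨⟨hxz, hzy⟩, hz⟩ i
    exact ⟨⟨(AffineA.vertex_sub_mem_iff hx hz).2 (AffineA.negCount_le_of_le hn hxz) i,
      (AffineA.vertex_sub_mem_iff hz hy).2 (AffineA.negCount_le_of_le hn hzy) i⟩,
      (AffineA.vertex_mem_closure_iff z i).2 (AffineA.antitone_window_ediv hz _)⟩
  · intro h
    have hz := AffineA.mem_dominantElements_of_vertex fun i => (h i).2
    exact ⟨⟨AffineA.le_of_negCount_le hn hx hz
        ((AffineA.vertex_sub_mem_iff hx hz).1 fun i => (h i).1.1),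
      AffineA.le_of_negCount_le hn hz hy
        ((AffineA.vertex_sub_mem_iff hz hy).1 fun i => (h i).1.2)⟩, hz⟩
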